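/- Let $g>0$, let $\pi_1$ be the fundamental group of the compact oriented surface $\Sigma_{g,1}$ of genus $g$ with one boundary component, based at a boundary point, identified with the free group on $\mathbf u_1,\mathbf v_1,\dots,\mathbf u_g,\mathbf v_g$ so that the boundary has class $\partial=\prod_{i=1}^g[\mathbf u_i,\mathbf v_i]$, and let $\mathcal M_{g,1}=\{\varphi\in\mathrm{Aut}(\pi_1):\varphi(\partial)=\partial\}$ be the mapping class group (in the form of Dehn–Nielsen). Let $H=\pi_1^{ab}\otimes\mathbb Q$, write $[\mathbf a]\in H$ for the class of $\mathbf a\in\pi_1$, let $\widehat T=\prod_{n\ge0}H^{\otimes n}$ be the completed tensor algebra, $\widehat T_1=\prod_{n\ge 1}H^{\otimes n}$, and let $\mathcal L\subset\bigoplus_n H^{\otimes n}$ be the free Lie algebra on $H$, i.e. the Lie subalgebra generated by $H$, with $\mathcal L_n=\mathcal L\cap H^{\otimes n}$. For $X,Y\in\widehat T_1$ put $h(X,Y)=\log(\exp X\exp Y)-X-Y$. A generalized Magnus expansion is a group homomorphism $\theta:\pi_1\to1+\widehat T_1$ with $\theta(\mathbf a)=1+[\mathbf a]+(\text{terms of degree}\ge2)$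 for all $\mathbf a\in\pi_1$. A trivalent bordered fatgraph $G$ of genus $g$ is a finite connected graph with a cyclic ordering of the half-edges at each vertex, all of whose vertices have valence three except for a single univalent one, with a single boundary cycle, such that gluing a disk along the boundary cycle gives a closed surface of genus $g$. Here the boundary cycle follows an oriented edge pointing into a vertex by the oriented edge pointing out of that vertex that is next in the cyclic ordering. The tail $\mathbf t$ is the edge at the univalent vertex, oriented away from it; $\bar{\mathbf x}$ is the oriented edge $\mathbf x$ reversed. A marking of $G$ is a map $\pi$ from the set $\mathcal E_{or}(G)$ of oriented edges to $\pi_1$ such that $\pi(\bar{\mathbf x})\pi(\mathbf x)=1$; $\pi(\mathbf e_1)\pi(\mathbf e_2)\pi(\mathbf e_3)=1$ whenever $\mathbf e_1,\mathbf e_2,\mathbf e_3$ are the oriented edges pointing into a trivalent vertex, in cyclic order; the image of $\pi$ generates $\pi_1$; and $\pi(\bar{\mathbf t})=\partial$. Its $H$-marking is $\mathbf x\mapsto[\pi(\mathbf x)]$. For $\varphi\in\mathcal M_{g,1}$, $\varphi(G)$ denotes $G$ with the marking $\varphi\circ\pi$. For $\mathbf x\in\mathcal E_{or}(G)$ let $\mathbf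 f_0=\mathbf x,\mathbf f_1,\dots,\mathbf f_k=\bar{\mathbf x}$ be the path from $\mathbf x$ to $\bar{\mathbf x}$ along the boundary cycle. It is said to avoid the tail if it does not contain the step from $\bar{\mathbf t}$ to $\mathbf t$ around the univalent vertex. **Theorem.** For each trivalent marked bordered fatgraph $G$ of genus $g$ there is exactly one map $\ell^G$ on $\mathcal E_{or}(G)$ with values in $\widehat T$ such that $\ell^G_0(\mathbf x)=0$, $\ell^G_1(\mathbf x)=[\pi(\mathbf x)]$ and, for all $n\ge2$, $$\ell^G_n(\mathbf x)=-\frac13\sum_{i=1}^k h\big(\ell^G(\mathbf f_{i-1}),-\ell^G(\mathbf f_i)\big)_{(n)}$$ if the path from $\mathbf x$ to $\bar{\mathbf x}$ avoids the tail, and $\ell^G_n(\mathbf x)=-\ell^G_n(\bar{\mathbf x})$ otherwise; moreover $\ell^G_n(\mathbf x)\in\mathcal L_n$ for all $n$. The map $\theta^G(\mathbf x)=\exp(\ell^G(\mathbf x))$ on $\mathcal E_{or}(G)$ extends along the marking to a generalized Magnus expansion $\theta^G:\pi_1\to1+\widehat T_1$, that is, $\theta^G(\pi(\mathbf x))=\exp(\ell^G(\mathbf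 x))$ for all $\mathbf x\in\mathcal E_{or}(G)$, and this extension is unique. On oriented edges $\theta^G$ depends only on the combinatorics and the $H$-marking of $G$: if an isomorphism of the underlying fatgraphs of $G$ and $G'$ takes the $H$-marking of $G$ to that of $G'$, it takes $\theta^G$ on $\mathcal E_{or}(G)$ to $\theta^{G'}$ on $\mathcal E_{or}(G')$. Finally, $\theta^G$ is $\mathcal M_{g,1}$-equivariant: $$\theta^G(\mathbf x)=|\varphi^{-1}|\,\theta^{\varphi(G)}(\varphi(\mathbf x))\qquad\text{for all }\varphi\in\mathcal M_{g,1},\ \mathbf x\in\pi_1,$$ where $|\varphi^{-1}|$ denotes the map on $\widehat T$ induced by the action of $\varphi^{-1}$ on $H$. -/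

import Mathlib

universe u

noncomputable section

namespace FatgraphMagnus

/-! ### The completed tensor algebra -/

section Tensor

variable (V : Type*) [AddCommGroup V] [Module ℚ V]

/-- The tensor power `V^{⊗ n}`, as the homogeneous part of degree `n` of the tensor algebra. -/
abbrev tensorPower (n : ℕ) : Submodule ℚ (TensorAlgebra ℚ V) :=
  LinearMap.range (TensorAlgebra.ι ℚ : V →ₗ[ℚ] TensorAlgebra ℚ V) ^ n

/-- The completed tensor algebra `∏ n, V^{⊗ n}`. An element is a sequence `(X n)` with
`X n ∈ V^{⊗ n}`, written as the power series `∑ X n * z ^ n` in a central bookkeeping variable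
`z`, so that the product is the Cauchy product `(X * Y) n = ∑_{i + j = n} X i * Y j`. -/
def CompletedTensorAlgebra : Subalgebra ℚ (PowerSeries (TensorAlgebra ℚ V)) where
  carrier := {X | ∀ n, PowerSeries.coeff n X ∈ tensorPower V n}
  mul_mem' := by
    intro X Y hX hY n
    rw [PowerSeries.coeff_mul]
    refine Submodule.sum_mem _ fun p hp => ?_
    rw [← Finset.HasAntidiagonal.mem_antidiagonal.mp hp, tensorPower, pow_add]
    exact Submodule.mul_mem_mul (hX p.1) (hY p.2)
  add_mem' := by
    intro X Y hX hY n
    rw [map_add]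
    exact Submodule.add_mem _ (hX n) (hY n)
  algebraMap_mem' := by
    intro r n
    rw [PowerSeries.algebraMap_apply, PowerSeries.coeff_C]
    split_ifs with h
    · subst h
      rw [tensorPower, pow_zero]
      exact Submodule.mem_one.mpr ⟨r, rfl⟩
    · exact Submodule.zero_mem _

end Tensor

section TensorOps

variable {V : Type*} [AddCommGroup V] [Module ℚ V]

/-- The component of degree `n`. -/
def comp (n : ℕ) (X : CompletedTensorAlgebra V) : TensorAlgebra ℚ V :=
  PowerSeries.coeff n (X : PowerSeries (TensorAlgebra ℚ V))

theorem comp_mem (n : ℕ) (X : CompletedTensorAlgebra V) : comp n X ∈ tensorPower V n :=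
  X.2 n

/-- The element of the completed tensor algebra with prescribed components. -/
def ofComp (X : ℕ → TensorAlgebra ℚ V) (hX : ∀ n, X n ∈ tensorPower V n) :
    CompletedTensorAlgebra V :=
  ⟨PowerSeries.mk X, fun n => by rw [PowerSeries.coeff_mk]; exact hX n⟩

/-- The inclusion of `V` as the homogeneous part of degree one. -/
def ofDegreeOne (v : V) : CompletedTensorAlgebra V :=
  ofComp (fun k => if k = 1 then TensorAlgebra.ι ℚ v else 0) fun k => by
    split_ifs with h
    · subst h
      rw [tensorPower, pow_one]
      exact ⟨v, rfl⟩
    · exact Submodule.zero_mem _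

/-- The homogeneous part of degree `n`, as an element of the completed tensor algebra. -/
def homogeneousPart (n : ℕ) (X : CompletedTensorAlgebra V) : CompletedTensorAlgebra V :=
  ofComp (fun k => if k = n then comp k X else 0) fun k => by
    split_ifs
    · exact comp_mem k X
    · exact Submodule.zero_mem _

/-- The sum `∑ c k • X ^ k` of a formal power series at an element `X` whose component of degree
zero vanishes: then `X ^ k` has no component of degree less than `k`, so that only the powers
with `k ≤ n` contribute to the component of degree `n`. -/
def evalSeries (c : ℕ → ℚ) (X : CompletedTensorAlgebra V) : CompletedTensorAlgebra V :=
  ofComp (fun n => ∑ k ∈ Finset.range (n + 1), c k • comp n (X ^ k)) fun n =>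
    Submodule.sum_mem _ fun k _ => Submodule.smul_mem _ _ (comp_mem n (X ^ k))

/-- `exp X = ∑ X ^ k / k!`, for `X` with vanishing component of degree zero. -/
def expT (X : CompletedTensorAlgebra V) : CompletedTensorAlgebra V :=
  evalSeries (fun k => 1 / (k.factorial : ℚ)) X

/-- `log U = ∑_{k ≥ 1} (-1) ^ (k + 1) (U - 1) ^ k / k`, for `U` with component one in degree
zero. -/
def logT (U : CompletedTensorAlgebra V) : CompletedTensorAlgebra V :=
  evalSeries (fun k => if k = 0 then 0 else (-1 : ℚ) ^ (k + 1) / (k : ℚ)) (U - 1)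

/-- The nonlinear part `h(X, Y) = log (exp X exp Y) - X - Y` of the Hausdorff series. -/
def hausdorff (X Y : CompletedTensorAlgebra V) : CompletedTensorAlgebra V :=
  logT (expT X * expT Y) - X - Y

attribute [local instance] LieRing.ofAssociativeRing in
variable (V) in
/-- The free Lie algebra on `V`, realized as the Lie subalgebra of the tensor algebra (with the
commutator bracket) generated by `V`. Its homogeneous part of degree `n` is its intersection with
`V^{⊗ n}`. -/
def freeLie : Submodule ℚ (TensorAlgebra ℚ V) :=
  (LieSubalgebra.lieSpan ℚ (TensorAlgebra ℚ V)
    (Set.range (TensorAlgebra.ι ℚ : V → TensorAlgebra ℚ V))).toSubmodule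

/-- The map induced by a linear map on tensor algebras. -/
def tensorMap {W : Type*} [AddCommGroup W] [Module ℚ W] (f : V →ₗ[ℚ] W) :
    TensorAlgebra ℚ V →ₐ[ℚ] TensorAlgebra ℚ W :=
  TensorAlgebra.lift ℚ (TensorAlgebra.ι ℚ ∘ₗ f)

theorem tensorMap_mem {W : Type*} [AddCommGroup W] [Module ℚ W] (f : V →ₗ[ℚ] W) (n : ℕ)
    {X : TensorAlgebra ℚ V} (hX : X ∈ tensorPower V n) : tensorMap f X ∈ tensorPower W n := by
  have h1 : Submodule.map (tensorMap f).toLinearMap (tensorPower V 1) ≤ tensorPower W 1 := by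
    rw [tensorPower, tensorPower, pow_one, pow_one]
    rintro _ ⟨_, ⟨v, rfl⟩, rfl⟩
    refine ⟨f v, ?_⟩
    simp [tensorMap]
  have h2 : Submodule.map (tensorMap f).toLinearMap (tensorPower V n) ≤ tensorPower W n := by
    rw [tensorPower, tensorPower, pow_one, pow_one] at h1
    rw [tensorPower, Submodule.map_pow, tensorPower]
    exact pow_le_pow_left' h1 n
  exact h2 ⟨X, hX, rfl⟩

/-- The map induced by a linear map on completed tensor algebras: in degree `n` it sends
`v 1 ⊗ ⋯ ⊗ v n` to `f (v 1) ⊗ ⋯ ⊗ f (v n)`. -/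
def completedTensorMap {W : Type*} [AddCommGroup W] [Module ℚ W] (f : V →ₗ[ℚ] W)
    (X : CompletedTensorAlgebra V) : CompletedTensorAlgebra W :=
  ofComp (fun n => tensorMap f (comp n X)) fun n => tensorMap_mem f n (comp_mem n X)

end TensorOps

/-! ### Rational homology of a group and generalized Magnus expansions -/

section Magnus

/-- The rational homology `F^{ab} ⊗ ℚ`. -/
abbrev RatHomology (F : Type*) [Group F] : Type _ :=
  TensorProduct ℤ ℚ (Additive (Abelianization F))

variable {F : Type*} [Group F]

/-- The class `[a]` of a group element in rational homology. -/
def homologyClass (a : F) : RatHomology F :=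
  (1 : ℚ) ⊗ₜ[ℤ] Additive.ofMul (Abelianization.of a)

/-- The map `|φ|` induced by a group automorphism on rational homology. -/
def homologyMap (φ : MulAut F) : RatHomology F →ₗ[ℚ] RatHomology F :=
  LinearMap.baseChange ℚ
    (MonoidHom.toAdditive (Abelianization.map (φ : F ≃* F).toMonoidHom)).toIntLinearMap

/-- A generalized Magnus expansion of `F` over `ℚ`: a group homomorphism `θ` from `F` to the
multiplicative group of elements `1 + (terms of degree ≥ 1)` of the completed tensor algebra of
the rational homology, such that `θ a = 1 + [a] + (terms of degree ≥ 2)`. -/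
def IsGeneralizedMagnusExpansion (θ : F →* CompletedTensorAlgebra (RatHomology F)) : Prop :=
  ∀ a, comp 0 (θ a) = 1 ∧ comp 1 (θ a) = TensorAlgebra.ι ℚ (homologyClass a)

end Magnus

/-! ### The fundamental group of the surface and the mapping class group -/

/-- The fundamental group of the compact oriented surface of genus `g` with one boundary
component, based at a boundary point: the free group on `u 1, …, u g` (the generators `inl i`)
and `v 1, …, v g` (the generators `inr i`). -/
abbrev SurfaceGroup (g : ℕ) : Type := FreeGroup (Fin g ⊕ Fin g)

/-- The class `[u 1, v 1] ⋯ [u g, v g]` of the boundary of the surface. -/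
def boundaryWord (g : ℕ) : SurfaceGroup g :=
  (List.ofFn fun i : Fin g =>
    FreeGroup.of (Sum.inl i) * FreeGroup.of (Sum.inr i) *
      (FreeGroup.of (Sum.inl i))⁻¹ * (FreeGroup.of (Sum.inr i))⁻¹).prod

/-- The mapping class group of the surface relative to its boundary, in the form of Dehn and
Nielsen: the automorphisms of the fundamental group that fix the class of the boundary. -/
def mappingClassGroup (g : ℕ) : Subgroup (MulAut (SurfaceGroup g)) :=
  MulAction.stabilizer (MulAut (SurfaceGroup g)) (boundaryWord g)

/-! ### Fatgraphs -/

/-- A fatgraph: a finite connected graph with a cyclic ordering of the half edges at each vertex.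
`E` is the set of oriented edges and `bar` reverses the orientation. A half edge at a vertex `v`
is recorded as the oriented edge pointing into `v` along it, and `next` sends it to the following
one in the cyclic ordering at `v`. Thus the vertices are the cycles of `next`. -/
structure Fatgraph where
  E : Type u
  finite : Finite E
  bar : Equiv.Perm E
  next : Equiv.Perm E
  bar_bar : ∀ x, bar (bar x) = x
  bar_ne : ∀ x, bar x ≠ x
  connected : ∀ x y, ∃ s ∈ Subgroup.closure ({bar, next} : Set (Equiv.Perm E)), s x = y

/-- The number of cycles (fixed points included) of a permutation. -/
def numCycles {α : Type*} (f : Equiv.Perm α) : ℕ :=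
  Nat.card (Quotient (Equiv.Perm.SameCycle.setoid f))

namespace Fatgraph

/-- The step along a boundary cycle: from an edge pointing into a vertex to the edge pointing
out of it that is next in the cyclic ordering. -/
def boundary (G : Fatgraph) : Equiv.Perm G.E :=
  G.next.trans G.bar

/-- `G` has genus `g`: gluing a 2-cell along each boundary cycle gives a closed surface of Euler
characteristic `V - E + F = 2 - 2 g`. -/
def HasGenus (G : Fatgraph) (g : ℕ) : Prop :=
  numCycles G.next + numCycles G.boundary + 2 * g = numCycles G.bar + 2

end Fatgraph

/-- A trivalent (once-)bordered fatgraph: there is a single boundary cycle, and all vertices have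
valence three except for a single univalent one. `tail` is the tail, oriented so that it points
away from the univalent vertex. -/
structure BorderedFatgraph extends Fatgraph.{u} where
  tail : E
  univalent : next (bar tail) = bar tail
  trivalent : ∀ x, x ≠ bar tail → next x ≠ x ∧ next (next (next x)) = x
  one_boundary : ∀ x y, toFatgraph.boundary.SameCycle x y

namespace BorderedFatgraph

variable (G : BorderedFatgraph.{u})

theorem exists_boundary_pow (x y : G.E) : ∃ k : ℕ, (G.boundary ^ k) x = y := by
  have := G.finite
  obtain ⟨k, _, hk⟩ := (G.one_boundary x y).exists_pow_eq'
  exact ⟨k, hk⟩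

open Classical in
/-- The number of steps that lead along the boundary cycle from `x` to `bar x`. -/
def pathLength (x : G.E) : ℕ := Nat.find (G.exists_boundary_pow x (G.bar x))

/-- The edge-path `x = f 0, f 1, …` along the boundary cycle. -/
def path (x : G.E) (i : ℕ) : G.E := (G.boundary ^ i) x

/-- The edge-path from `x` to `bar x` along the boundary cycle avoids the tail, i.e. it does not
turn around at the univalent vertex (which it would do in the step from `bar tail` to `tail`).
For `x` other than `tail` and `bar tail` this says that neither of these lies on the path. The
path from `tail` to `bar tail`, the whole boundary cycle, qualifies. -/
def AvoidsTail (x : G.E) : Prop := ∀ i < G.pathLength x, G.path x i ≠ G.bar G.tail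

variable {V : Type*} [AddCommGroup V] [Module ℚ V]

/-- `∑_{i = 1}^{k} h(L (f (i - 1)), - L (f i))` along the edge-path `f 0, …, f k` from `x` to
`bar x`. -/
def pathSum (L : G.E → CompletedTensorAlgebra V) (x : G.E) : CompletedTensorAlgebra V :=
  ∑ i ∈ Finset.range (G.pathLength x), hausdorff (L (G.path x i)) (-L (G.path x (i + 1)))

open Classical in
/-- The approximations of `ell` that consist of the terms of degree at most `n`. The term of
degree one is the given marking `m`, and the term of degree `n + 2` is computed from those of
lower degree. -/
def ellApprox (m : G.E → V) : ℕ → G.E → CompletedTensorAlgebra V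
  | 0 => fun _ => 0
  | 1 => fun x => ofDegreeOne (m x)
  | n + 2 => fun x => ellApprox m (n + 1) x + homogeneousPart (n + 2)
      (if G.AvoidsTail x then (-(1 / 3 : ℚ)) • G.pathSum (ellApprox m (n + 1)) x
        else (1 / 3 : ℚ) • G.pathSum (ellApprox m (n + 1)) (G.bar x))

/-- The map `ℓ` on oriented edges, determined by the fatgraph and a marking `m` of its oriented
edges by elements of `V`. -/
def ell (m : G.E → V) (x : G.E) : CompletedTensorAlgebra V :=
  ofComp (fun n => comp n (G.ellApprox m n x)) fun n => comp_mem n _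

/-- The recursion for `ℓ`: `ℓ_0(x) = 0`, `ℓ_1(x) = m x`, and for `n ≥ 2`
`ℓ_n(x) = -(1/3) ∑_{i = 1}^{k} h(ℓ(f (i - 1)), -ℓ(f i))_(n)` if the path from `x` to `bar x`
avoids the tail, and `ℓ_n(x) = -ℓ_n(bar x)` otherwise. -/
def SolvesRecursion (m : G.E → V) (L : G.E → CompletedTensorAlgebra V) : Prop :=
  ∀ x, comp 0 (L x) = 0 ∧ comp 1 (L x) = TensorAlgebra.ι ℚ (m x) ∧
    ∀ n, 2 ≤ n →
      (G.AvoidsTail x → comp n (L x) = (-(1 / 3 : ℚ)) •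
        ∑ i ∈ Finset.range (G.pathLength x),
          comp n (hausdorff (L (G.path x i)) (-L (G.path x (i + 1))))) ∧
      (¬ G.AvoidsTail x → comp n (L x) = -comp n (L (G.bar x)))

end BorderedFatgraph

/-- A trivalent marked bordered fatgraph of genus `g`, the marking being given by elements of the
fundamental group on the oriented edges. -/
structure MarkedFatgraph (g : ℕ) extends BorderedFatgraph.{u} where
  genus : toFatgraph.HasGenus g
  marking : E → SurfaceGroup g
  orientation : ∀ x, marking (bar x) * marking x = 1
  vertex : ∀ x, x ≠ bar tail → marking x * marking (next x) * marking (next (next x)) = 1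
  full_rank : Subgroup.closure (Set.range marking) = ⊤
  geometric : marking (bar tail) = boundaryWord g

namespace MarkedFatgraph

variable {g : ℕ}

/-- The `H`-marking of a marked fatgraph. -/
def hMarking (G : MarkedFatgraph.{u} g) (x : G.E) : RatHomology (SurfaceGroup g) :=
  homologyClass (G.marking x)

/-- `θ(x) = exp (ℓ(x))` on the oriented edges of a marked fatgraph. -/
def theta (G : MarkedFatgraph.{u} g) (x : G.E) :
    CompletedTensorAlgebra (RatHomology (SurfaceGroup g)) :=
  expT (G.ell G.hMarking x)

/-- The marked fatgraph `φ(G)`: the fatgraph `G`, its marking composed with `φ`. -/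
def act (φ : mappingClassGroup g) (G : MarkedFatgraph.{u} g) : MarkedFatgraph.{u} g where
  toBorderedFatgraph := G.toBorderedFatgraph
  genus := G.genus
  marking x := φ.1 (G.marking x)
  orientation x := by rw [← map_mul, G.orientation, map_one]
  vertex x hx := by rw [← map_mul, ← map_mul, G.vertex x hx, map_one]
  full_rank := by
    have h : Set.range (fun x => φ.1 (G.marking x)) =
        (φ.1 : SurfaceGroup g ≃* SurfaceGroup g).toMonoidHom '' Set.range G.marking := by
      ext y
      simp
    rw [h, ← MonoidHom.map_closure, G.full_rank]
    exact Subgroup.map_top_of_surjective _ (MulEquiv.surjective φ.1)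
  geometric := by rw [G.geometric]; exact φ.2

/-- An isomorphism of the underlying fatgraphs of `G` and `G'` that matches their `H`-markings. -/
structure HIso (G G' : MarkedFatgraph.{u} g) where
  toEquiv : G.E ≃ G'.E
  map_bar : ∀ x, toEquiv (G.bar x) = G'.bar (toEquiv x)
  map_next : ∀ x, toEquiv (G.next x) = G'.next (toEquiv x)
  map_hMarking : ∀ x, G'.hMarking (toEquiv x) = G.hMarking x

end MarkedFatgraph

end FatgraphMagnus

end

open FatgraphMagnus

/-!
Write `c i = h(ℓ(f_{i-1}), -ℓ(f_i))` for the corner terms along the boundary cycle. The degree `n`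
part of `c` involves only degrees below `n` of `ℓ`, so the recursion has exactly one solution, with
values in the free Lie algebra by the Baker–Campbell–Hausdorff theorem. The latter is proved with
the Euler derivation `D`, which multiplies degree `n` by `n`: it expresses `D Z` for
`Z = log (exp X exp Y)` through iterated brackets of `D X`, `D Y` and lower degrees of `Z`.

The complement of the step around the tail is a segment, on which the corner terms of degree `n`
have partial sums; `-3 ℓ_n(x)` is the difference of these sums at `bar x` and `x`. Summed over the
three edges pointing into a vertex the differences regroup to the sum of the three corner terms
there. If `exp ℓ(x) exp ℓ(y) exp ℓ(z) = 1` holds in degrees below `n` for the edges `x`, `y`, `z`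
pointing into each vertex, then the three corner terms at a vertex agree in degree `n`, so the
factor `1/3` makes the relation hold in degree `n` as well.

Hence `exp ∘ ℓ` satisfies the relations of a marking. The edges by which the boundary cycle reaches
each trivalent vertex for the first time form a spanning tree, and the remaining `2g` edges generate
the fundamental group. A free group of finite rank is Hopfian, so they generate it freely, and every
map that satisfies the relations of a marking extends to a homomorphism. Invariance and equivariance
follow from the uniqueness of the solution of the recursion and of the extension.
-/

namespace FatgraphMagnus

open Finset.HasAntidiagonal (antidiagonal mem_antidiagonal)

/-! ### The filtration of the completed tensor algebra by degree -/

section Filtration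

variable {V : Type*} [AddCommGroup V] [Module ℚ V]

theorem ext_comp {X Y : CompletedTensorAlgebra V} (h : ∀ n, comp n X = comp n Y) : X = Y :=
  Subtype.ext (PowerSeries.ext h)

@[simp]
theorem comp_ofComp (n : ℕ) (X : ℕ → TensorAlgebra ℚ V) (hX : ∀ n, X n ∈ tensorPower V n) :
    comp n (ofComp X hX) = X n :=
  PowerSeries.coeff_mk _ _

@[simp]
theorem comp_zero (n : ℕ) : comp n (0 : CompletedTensorAlgebra V) = 0 :=
  map_zero (PowerSeries.coeff n)

@[simp]
theorem comp_add (n : ℕ) (X Y : CompletedTensorAlgebra V) :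
    comp n (X + Y) = comp n X + comp n Y :=
  map_add (PowerSeries.coeff n) _ _

@[simp]
theorem comp_sub (n : ℕ) (X Y : CompletedTensorAlgebra V) :
    comp n (X - Y) = comp n X - comp n Y :=
  map_sub (PowerSeries.coeff n) _ _

@[simp]
theorem comp_neg (n : ℕ) (X : CompletedTensorAlgebra V) : comp n (-X) = -comp n X :=
  map_neg (PowerSeries.coeff n) _

@[simp]
theorem comp_smul (n : ℕ) (c : ℚ) (X : CompletedTensorAlgebra V) :
    comp n (c • X) = c • comp n X :=
  rfl

theorem comp_sum {ι : Type*} (n : ℕ) (s : Finset ι) (X : ι → CompletedTensorAlgebra V) :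
    comp n (∑ i ∈ s, X i) = ∑ i ∈ s, comp n (X i) := by
  simp only [comp, AddSubmonoidClass.coe_finsetSum, map_sum]

theorem comp_mul (n : ℕ) (X Y : CompletedTensorAlgebra V) :
    comp n (X * Y) = ∑ p ∈ antidiagonal n, comp p.1 X * comp p.2 Y :=
  PowerSeries.coeff_mul n _ _

theorem comp_one (n : ℕ) : comp n (1 : CompletedTensorAlgebra V) = if n = 0 then 1 else 0 :=
  PowerSeries.coeff_one n

theorem comp_zero_mul (X Y : CompletedTensorAlgebra V) :
    comp 0 (X * Y) = comp 0 X * comp 0 Y := by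
  simp [comp_mul]

theorem comp_one_mul (X Y : CompletedTensorAlgebra V) :
    comp 1 (X * Y) = comp 0 X * comp 1 Y + comp 1 X * comp 0 Y := by
  rw [comp_mul, Finset.Nat.antidiagonal_succ]
  simp

variable (V) in
/-- The subspace `∏ n ≥ N, V^{⊗ n}` of the completed tensor algebra. Congruences modulo these
subspaces are written `X ≡ Y [SMOD degreeFiltration V N]`. -/
def degreeFiltration (N : ℕ) : Submodule ℚ (CompletedTensorAlgebra V) where
  carrier := {X | ∀ n < N, comp n X = 0}
  add_mem' hX hY n hn := by rw [comp_add, hX n hn, hY n hn, add_zero]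
  zero_mem' n _ := comp_zero n
  smul_mem' c X hX n hn := by rw [comp_smul, hX n hn, smul_zero]

theorem degreeFiltration_antitone : Antitone (degreeFiltration V) :=
  fun _ _ h _ hX n hn => hX n (hn.trans_le h)

theorem mem_degreeFiltration_zero (X : CompletedTensorAlgebra V) : X ∈ degreeFiltration V 0 :=
  fun _ hn => absurd hn (Nat.not_lt_zero _)

theorem mem_degreeFiltration_one {X : CompletedTensorAlgebra V} :
    X ∈ degreeFiltration V 1 ↔ comp 0 X = 0 :=
  ⟨fun h => h 0 zero_lt_one, fun h n hn => by rwa [Nat.lt_one_iff.mp hn]⟩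

theorem mul_mem_degreeFiltration {M N : ℕ} {X Y : CompletedTensorAlgebra V}
    (hX : X ∈ degreeFiltration V M) (hY : Y ∈ degreeFiltration V N) :
    X * Y ∈ degreeFiltration V (M + N) := by
  intro n hn
  rw [comp_mul]
  refine Finset.sum_eq_zero fun p hp => ?_
  rw [mem_antidiagonal] at hp
  rcases lt_or_ge p.1 M with h | h
  · rw [hX _ h, zero_mul]
  · rw [hY _ (by omega), mul_zero]

theorem mul_mem_degreeFiltration_left {N : ℕ} {X : CompletedTensorAlgebra V}
    (hX : X ∈ degreeFiltration V N) (Y : CompletedTensorAlgebra V) :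
    X * Y ∈ degreeFiltration V N :=
  mul_mem_degreeFiltration hX (mem_degreeFiltration_zero Y)

theorem mul_mem_degreeFiltration_right {N : ℕ} (X : CompletedTensorAlgebra V)
    {Y : CompletedTensorAlgebra V} (hY : Y ∈ degreeFiltration V N) :
    X * Y ∈ degreeFiltration V N := by
  simpa using mul_mem_degreeFiltration (mem_degreeFiltration_zero X) hY

theorem pow_mem_degreeFiltration {X : CompletedTensorAlgebra V} (hX : comp 0 X = 0) (k : ℕ) :
    X ^ k ∈ degreeFiltration V k := by
  induction k with
  | zero => exact mem_degreeFiltration_zero _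
  | succ k ih => exact mul_mem_degreeFiltration ih (mem_degreeFiltration_one.mpr hX)

theorem comp_eq_of_smodEq {N n : ℕ} {X Y : CompletedTensorAlgebra V}
    (h : X ≡ Y [SMOD degreeFiltration V N]) (hn : n < N) : comp n X = comp n Y :=
  sub_eq_zero.mp ((comp_sub n X Y).symm.trans (SModEq.sub_mem.mp h n hn))

theorem smodEq_degreeFiltration {N : ℕ} {X Y : CompletedTensorAlgebra V} :
    X ≡ Y [SMOD degreeFiltration V N] ↔ ∀ n < N, comp n X = comp n Y :=
  ⟨fun h _ => comp_eq_of_smodEq h, fun h => SModEq.sub_mem.mpr fun n hn => by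
    rw [comp_sub, h n hn, sub_self]⟩

theorem eq_of_forall_smodEq {X Y : CompletedTensorAlgebra V}
    (h : ∀ N, X ≡ Y [SMOD degreeFiltration V N]) : X = Y :=
  ext_comp fun n => comp_eq_of_smodEq (h (n + 1)) n.lt_succ_self

theorem smodEq_mul {N : ℕ} {X X' Y Y' : CompletedTensorAlgebra V}
    (hX : X ≡ X' [SMOD degreeFiltration V N]) (hY : Y ≡ Y' [SMOD degreeFiltration V N]) :
    X * Y ≡ X' * Y' [SMOD degreeFiltration V N] := by
  rw [SModEq.sub_mem] at hX hY ⊢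
  rw [show X * Y - X' * Y' = (X - X') * Y + X' * (Y - Y') by
    rw [sub_mul, mul_sub, sub_add_sub_cancel]]
  exact add_mem (mul_mem_degreeFiltration_left hX _) (mul_mem_degreeFiltration_right _ hY)

theorem smodEq_pow {N : ℕ} {X Y : CompletedTensorAlgebra V}
    (h : X ≡ Y [SMOD degreeFiltration V N]) (k : ℕ) :
    X ^ k ≡ Y ^ k [SMOD degreeFiltration V N] := by
  induction k with
  | zero => simp only [pow_zero, SModEq.rfl]
  | succ k ih => simpa only [pow_succ] using smodEq_mul ih h

theorem smodEq_mul_succ {N : ℕ} {X X' Y Y' : CompletedTensorAlgebra V} (hX0 : comp 0 X' = 0)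
    (hY0 : comp 0 Y = 0) (hX : X ≡ X' [SMOD degreeFiltration V N])
    (hY : Y ≡ Y' [SMOD degreeFiltration V N]) :
    X * Y ≡ X' * Y' [SMOD degreeFiltration V (N + 1)] := by
  rw [SModEq.sub_mem] at hX hY ⊢
  rw [show X * Y - X' * Y' = (X - X') * Y + X' * (Y - Y') by
    rw [sub_mul, mul_sub, sub_add_sub_cancel]]
  refine add_mem (mul_mem_degreeFiltration hX (mem_degreeFiltration_one.mpr hY0)) ?_
  rw [add_comm N]
  exact mul_mem_degreeFiltration (mem_degreeFiltration_one.mpr hX0) hY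

theorem mul_smodEq_left {N : ℕ} {X U : CompletedTensorAlgebra V}
    (hX : X ∈ degreeFiltration V N) (hU : comp 0 U = 1) :
    X * U ≡ X [SMOD degreeFiltration V (N + 1)] := by
  rw [SModEq.sub_mem, ← mul_sub_one]
  exact mul_mem_degreeFiltration hX (mem_degreeFiltration_one.mpr (by simp [hU, comp_one]))

theorem mul_smodEq_right {N : ℕ} {X U : CompletedTensorAlgebra V}
    (hX : X ∈ degreeFiltration V N) (hU : comp 0 U = 1) :
    U * X ≡ X [SMOD degreeFiltration V (N + 1)] := by
  rw [SModEq.sub_mem, ← sub_one_mul, add_comm N]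
  exact mul_mem_degreeFiltration (mem_degreeFiltration_one.mpr (by simp [hU, comp_one])) hX

/-- The sum of a sequence that converges in the degree filtration because its `k`-th term has no
component of degree less than `k`. -/
noncomputable def sumT (a : ℕ → CompletedTensorAlgebra V) : CompletedTensorAlgebra V :=
  ofComp (fun n => ∑ k ∈ Finset.range (n + 1), comp n (a k)) fun n =>
    Submodule.sum_mem _ fun k _ => comp_mem n (a k)

theorem sumT_smodEq {a : ℕ → CompletedTensorAlgebra V} (ha : ∀ k, a k ∈ degreeFiltration V k)
    (N : ℕ) : sumT a ≡ ∑ k ∈ Finset.range N, a k [SMOD degreeFiltration V N] := by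
  refine smodEq_degreeFiltration.mpr fun n hn => ?_
  rw [sumT, comp_ofComp, comp_sum]
  refine Finset.sum_subset (Finset.range_mono hn) fun k _ hk => ha k n ?_
  simpa using hk

theorem sumT_eq_head_add {a : ℕ → CompletedTensorAlgebra V}
    (ha : ∀ k, a k ∈ degreeFiltration V k) : sumT a = a 0 + sumT fun k => a (k + 1) := by
  have hsucc : ∀ k, a (k + 1) ∈ degreeFiltration V k :=
    fun k => degreeFiltration_antitone k.le_succ (ha _)
  refine eq_of_forall_smodEq fun N => ?_
  refine ((sumT_smodEq ha (N + 1)).mono (degreeFiltration_antitone N.le_succ)).trans ?_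
  rw [Finset.sum_range_succ', add_comm]
  exact SModEq.rfl.add (sumT_smodEq hsucc N).symm

theorem sum_mul_sum_smodEq {a b : ℕ → CompletedTensorAlgebra V}
    (ha : ∀ k, a k ∈ degreeFiltration V k) (hb : ∀ k, b k ∈ degreeFiltration V k) (N : ℕ) :
    (∑ i ∈ Finset.range N, a i) * ∑ j ∈ Finset.range N, b j ≡
      ∑ n ∈ Finset.range N, ∑ p ∈ antidiagonal n, a p.1 * b p.2
      [SMOD degreeFiltration V N] := by
  simp only [Finset.Nat.sum_antidiagonal_eq_sum_range_succ fun i j => a i * b j]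
  rw [Finset.sum_range_diag_flip N fun i j => a i * b j, Finset.sum_mul_sum]
  refine SModEq.sum fun i _ => smodEq_degreeFiltration.mpr fun n hn => ?_
  rw [comp_sum, comp_sum]
  refine (Finset.sum_subset (Finset.range_mono (N.sub_le i)) fun j _ hj => ?_).symm
  rw [Finset.mem_range, not_lt] at hj
  exact mul_mem_degreeFiltration (ha i) (hb j) n (by omega)

theorem sumT_mul {a b : ℕ → CompletedTensorAlgebra V} (ha : ∀ k, a k ∈ degreeFiltration V k)
    (hb : ∀ k, b k ∈ degreeFiltration V k) :
    sumT a * sumT b = sumT fun n => ∑ p ∈ antidiagonal n, a p.1 * b p.2 := by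
  have hab : ∀ n, ∑ p ∈ antidiagonal n, a p.1 * b p.2 ∈ degreeFiltration V n :=
    fun n => sum_mem fun p hp =>
      mem_antidiagonal.mp hp ▸ mul_mem_degreeFiltration (ha p.1) (hb p.2)
  refine eq_of_forall_smodEq fun N => ?_
  calc sumT a * sumT b
      ≡ (∑ i ∈ Finset.range N, a i) * ∑ j ∈ Finset.range N, b j [SMOD degreeFiltration V N] :=
        smodEq_mul (sumT_smodEq ha N) (sumT_smodEq hb N)
    _ ≡ ∑ n ∈ Finset.range N, ∑ p ∈ antidiagonal n, a p.1 * b p.2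
        [SMOD degreeFiltration V N] := sum_mul_sum_smodEq ha hb N
    _ ≡ sumT fun n => ∑ p ∈ antidiagonal n, a p.1 * b p.2 [SMOD degreeFiltration V N] :=
        (sumT_smodEq hab N).symm

theorem sumT_mul_right {a : ℕ → CompletedTensorAlgebra V} (ha : ∀ k, a k ∈ degreeFiltration V k)
    (X : CompletedTensorAlgebra V) : sumT a * X = sumT fun k => a k * X := by
  refine eq_of_forall_smodEq fun N => ?_
  refine (smodEq_mul (sumT_smodEq ha N) (SModEq.refl X)).trans ?_
  rw [Finset.sum_mul]
  exact (sumT_smodEq (fun k => mul_mem_degreeFiltration_left (ha k) X) N).symm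

end Filtration

/-! ### Power series, the exponential and the logarithm -/

theorem exp_subst_log : (PowerSeries.exp ℚ).subst (PowerSeries.log ℚ) = 1 + PowerSeries.X := by
  have hone : PowerSeries.constantCoeff (1 + PowerSeries.X : PowerSeries ℚ) ≠ 0 := by simp
  have hlog : PowerSeries.derivative ℚ (PowerSeries.log ℚ) = (1 + PowerSeries.X)⁻¹ := by
    rw [PowerSeries.eq_inv_iff_mul_eq_one hone, PowerSeries.deriv_log]
    ext n
    cases n with
    | zero => simp
    | succ n => simp [mul_add, PowerSeries.coeff_succ_mul_X, PowerSeries.coeff_one, pow_succ]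
  have hquot : (PowerSeries.exp ℚ).subst (PowerSeries.log ℚ) * (1 + PowerSeries.X)⁻¹ = 1 := by
    refine PowerSeries.derivative.ext ?_ ?_
    · rw [Derivation.leibniz, PowerSeries.derivative_subst PowerSeries.HasSubst.log,
        PowerSeries.derivative_exp, PowerSeries.derivative_inv', hlog, PowerSeries.derivative_one,
        map_add, PowerSeries.derivative_one, PowerSeries.derivative_X]
      simp only [smul_eq_mul]
      ring
    · have hconst : PowerSeries.constantCoeff
          ((PowerSeries.exp ℚ).subst (PowerSeries.log ℚ)) = 1 := by
        rw [← PowerSeries.coeff_zero_eq_constantCoeff_apply,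
          PowerSeries.coeff_subst' PowerSeries.HasSubst.log, finsum_eq_single _ 0]
        · simp
        · intro k hk
          simp [map_pow, PowerSeries.constantCoeff_log, zero_pow hk]
      rw [map_mul, hconst]
      simp
  calc (PowerSeries.exp ℚ).subst (PowerSeries.log ℚ)
      = (PowerSeries.exp ℚ).subst (PowerSeries.log ℚ) * (1 + PowerSeries.X)⁻¹ *
          (1 + PowerSeries.X) := by rw [mul_assoc, PowerSeries.inv_mul_cancel _ hone, mul_one]
    _ = 1 + PowerSeries.X := by rw [hquot, one_mul]

section Evaluation

variable {V : Type*} [AddCommGroup V] [Module ℚ V]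

theorem evalSeries_eq_sumT (c : ℕ → ℚ) (X : CompletedTensorAlgebra V) :
    evalSeries c X = sumT fun k => c k • X ^ k :=
  ext_comp fun n => by simp [evalSeries, sumT]

theorem smul_pow_mem_degreeFiltration {X : CompletedTensorAlgebra V} (hX : comp 0 X = 0)
    (c : ℕ → ℚ) (k : ℕ) : c k • X ^ k ∈ degreeFiltration V k :=
  Submodule.smul_mem _ _ (pow_mem_degreeFiltration hX k)

theorem evalSeries_smodEq {X : CompletedTensorAlgebra V} (hX : comp 0 X = 0) (c : ℕ → ℚ) (N : ℕ) :
    evalSeries c X ≡ ∑ k ∈ Finset.range N, c k • X ^ k [SMOD degreeFiltration V N] :=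
  evalSeries_eq_sumT c X ▸ sumT_smodEq (smul_pow_mem_degreeFiltration hX c) N

theorem evalSeries_eq_sum {c : ℕ → ℚ} {X : CompletedTensorAlgebra V} (hX : comp 0 X = 0) {N : ℕ}
    (hc : ∀ k, N ≤ k → c k = 0) : evalSeries c X = ∑ k ∈ Finset.range N, c k • X ^ k := by
  refine eq_of_forall_smodEq fun M => ?_
  refine ((evalSeries_smodEq hX c (M + N)).mono
    (degreeFiltration_antitone (M.le_add_right N))).trans ?_
  rw [Finset.sum_subset (Finset.range_mono (N.le_add_left M)) fun k _ hk => by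
    rw [hc k (by simpa using hk), zero_smul]]

/-- Evaluation of formal power series at an element without constant term. -/
noncomputable def evalHom (X : CompletedTensorAlgebra V) (hX : comp 0 X = 0) :
    PowerSeries ℚ →ₐ[ℚ] CompletedTensorAlgebra V :=
  AlgHom.ofLinearMap
    { toFun f := evalSeries (fun k => PowerSeries.coeff k f) X
      map_add' f g := ext_comp fun n => by simp [evalSeries, add_smul, Finset.sum_add_distrib]
      map_smul' c f := ext_comp fun n => by simp [evalSeries, Finset.smul_sum, smul_smul] }
    (by
      refine (evalSeries_eq_sum (N := 1) hX fun k hk => ?_).trans (by simp)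
      simp [PowerSeries.coeff_one, Nat.one_le_iff_ne_zero.mp hk])
    (fun f g => by
      simp only [LinearMap.coe_mk, AddHom.coe_mk, evalSeries_eq_sumT]
      rw [sumT_mul (smul_pow_mem_degreeFiltration hX _) (smul_pow_mem_degreeFiltration hX _)]
      congr 1 with n : 1
      rw [PowerSeries.coeff_mul, Finset.sum_smul]
      refine Finset.sum_congr rfl fun p hp => ?_
      rw [smul_mul_smul_comm, ← pow_add, mem_antidiagonal.mp hp])

theorem evalHom_apply {X : CompletedTensorAlgebra V} (hX : comp 0 X = 0) (f : PowerSeries ℚ) :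
    evalHom X hX f = evalSeries (fun k => PowerSeries.coeff k f) X :=
  rfl

theorem evalHom_smodEq {X : CompletedTensorAlgebra V} (hX : comp 0 X = 0) (f : PowerSeries ℚ)
    (N : ℕ) : evalHom X hX f ≡ ∑ k ∈ Finset.range N, PowerSeries.coeff k f • X ^ k
      [SMOD degreeFiltration V N] :=
  evalSeries_smodEq hX _ N

theorem evalHom_X {X : CompletedTensorAlgebra V} (hX : comp 0 X = 0) :
    evalHom X hX PowerSeries.X = X := by
  refine (evalSeries_eq_sum (N := 2) hX fun k hk => ?_).trans ?_
  · rw [PowerSeries.coeff_X, if_neg (by omega)]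
  · simp [Finset.sum_range_succ]

theorem comp_zero_evalSeries (c : ℕ → ℚ) (X : CompletedTensorAlgebra V) :
    comp 0 (evalSeries c X) = c 0 • 1 := by
  simp [evalSeries, comp_one]

theorem comp_zero_evalHom {X : CompletedTensorAlgebra V} (hX : comp 0 X = 0) {f : PowerSeries ℚ}
    (hf : PowerSeries.constantCoeff f = 0) : comp 0 (evalHom X hX f) = 0 := by
  rw [evalHom_apply, comp_zero_evalSeries, PowerSeries.coeff_zero_eq_constantCoeff_apply, hf,
    zero_smul]

theorem coeff_subst_eq_sum {f : PowerSeries ℚ} (hf : PowerSeries.constantCoeff f = 0)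
    (g : PowerSeries ℚ) {k N : ℕ} (hk : k < N) : PowerSeries.coeff k (g.subst f) =
      ∑ d ∈ Finset.range N, PowerSeries.coeff d g * PowerSeries.coeff k (f ^ d) := by
  rw [PowerSeries.coeff_subst' (PowerSeries.HasSubst.of_constantCoeff_zero' hf)]
  refine finsum_eq_sum_of_support_subset _ fun d hd => ?_
  by_contra hdN
  refine hd ?_
  have hkd : (k : ℕ∞) < d := by
    exact_mod_cast hk.trans_le (by simpa using hdN)
  simp only [PowerSeries.coeff_of_lt_order k
    (hkd.trans_le (PowerSeries.le_order_pow_of_constantCoeff_eq_zero d hf)), smul_zero]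

theorem evalHom_subst {X : CompletedTensorAlgebra V} (hX : comp 0 X = 0) {f : PowerSeries ℚ}
    (hf : PowerSeries.constantCoeff f = 0) (g : PowerSeries ℚ) :
    evalHom X hX (g.subst f) = evalHom (evalHom X hX f) (comp_zero_evalHom hX hf) g := by
  refine eq_of_forall_smodEq fun N => ?_
  calc evalHom X hX (g.subst f)
      ≡ ∑ k ∈ Finset.range N, PowerSeries.coeff k (g.subst f) • X ^ k
        [SMOD degreeFiltration V N] := evalHom_smodEq hX _ N
    _ = ∑ d ∈ Finset.range N, PowerSeries.coeff d g •
          ∑ k ∈ Finset.range N, PowerSeries.coeff k (f ^ d) • X ^ k := by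
        simp only [Finset.smul_sum, smul_smul]
        rw [Finset.sum_comm]
        refine Finset.sum_congr rfl fun k hk => ?_
        rw [coeff_subst_eq_sum hf g (Finset.mem_range.mp hk), Finset.sum_smul]
    _ ≡ ∑ d ∈ Finset.range N, PowerSeries.coeff d g • evalHom X hX f ^ d
        [SMOD degreeFiltration V N] := by
        simp only [← map_pow]
        exact SModEq.sum fun d _ => (evalHom_smodEq hX (f ^ d) N).symm.smul _
    _ ≡ evalHom (evalHom X hX f) (comp_zero_evalHom hX hf) g [SMOD degreeFiltration V N] :=
        (evalHom_smodEq _ g N).symm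

end Evaluation

section ExpLog

variable {V : Type*} [AddCommGroup V] [Module ℚ V]

theorem expT_eq_evalHom {X : CompletedTensorAlgebra V} (hX : comp 0 X = 0) :
    expT X = evalHom X hX (PowerSeries.exp ℚ) := by
  simp [expT, evalHom_apply, PowerSeries.coeff_exp]

theorem logT_eq_evalHom {U : CompletedTensorAlgebra V} (hU : comp 0 (U - 1) = 0) :
    logT U = evalHom (U - 1) hU (PowerSeries.log ℚ) := by
  simp [logT, evalHom_apply, PowerSeries.coeff_log]

theorem comp_zero_expT (X : CompletedTensorAlgebra V) : comp 0 (expT X) = 1 := by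
  simp [expT, comp_zero_evalSeries]

theorem comp_zero_logT (U : CompletedTensorAlgebra V) : comp 0 (logT U) = 0 := by
  simp [logT, comp_zero_evalSeries]

theorem expT_logT {U : CompletedTensorAlgebra V} (hU : comp 0 U = 1) : expT (logT U) = U := by
  have hU1 : comp 0 (U - 1) = 0 := by simp [comp_one, hU]
  rw [expT_eq_evalHom (comp_zero_logT U)]
  simp only [logT_eq_evalHom hU1]
  rw [← evalHom_subst hU1 PowerSeries.constantCoeff_log, exp_subst_log, map_add, map_one,
    evalHom_X, add_sub_cancel]

theorem expT_zero : expT (0 : CompletedTensorAlgebra V) = 1 := by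
  refine ext_comp fun n => ?_
  rw [expT, evalSeries, comp_ofComp, Finset.sum_eq_single 0]
  · simp
  · intro k _ hk
    simp [hk]
  · simp

theorem evalHom_neg {X : CompletedTensorAlgebra V} (hX : comp 0 X = 0) (hX' : comp 0 (-X) = 0)
    (f : PowerSeries ℚ) : evalHom (-X) hX' f = evalHom X hX (PowerSeries.evalNegHom f) := by
  refine ext_comp fun n => ?_
  simp only [evalHom_apply, evalSeries, comp_ofComp]
  refine Finset.sum_congr rfl fun k _ => ?_
  rw [PowerSeries.evalNegHom, PowerSeries.coeff_rescale, ← neg_one_smul ℚ X, smul_pow, comp_smul,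
    smul_smul, mul_comm]

theorem expT_mul_expT_neg {X : CompletedTensorAlgebra V} (hX : comp 0 X = 0) :
    expT X * expT (-X) = 1 := by
  have hX' : comp 0 (-X) = 0 := by rw [comp_neg, hX, neg_zero]
  rw [expT_eq_evalHom hX, expT_eq_evalHom hX', evalHom_neg hX, ← map_mul,
    PowerSeries.exp_mul_exp_neg_eq_one, map_one]

theorem expT_neg_mul_expT {X : CompletedTensorAlgebra V} (hX : comp 0 X = 0) :
    expT (-X) * expT X = 1 := by
  simpa using expT_mul_expT_neg (X := -X) (by simp [hX])

theorem expT_sub_expT_smodEq {n : ℕ} {X Y : CompletedTensorAlgebra V} (hX : comp 0 X = 0)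
    (h : X ≡ Y [SMOD degreeFiltration V (n + 1)]) :
    expT X - expT Y ≡ X - Y [SMOD degreeFiltration V (n + 2)] := by
  have hY : comp 0 Y = 0 := (comp_eq_of_smodEq h n.succ_pos).symm.trans hX
  have hpow : ∀ k, X ^ (k + 2) ≡ Y ^ (k + 2) [SMOD degreeFiltration V (n + 2)] := fun k => by
    rw [pow_succ, pow_succ Y]
    exact smodEq_mul_succ (mem_degreeFiltration_one.mp (degreeFiltration_antitone
      (Nat.le_add_left 1 k) (pow_mem_degreeFiltration hY (k + 1)))) hX (smodEq_pow h _) h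
  refine ((evalSeries_smodEq hX _ (n + 2)).sub (evalSeries_smodEq hY _ (n + 2))).trans ?_
  rw [← Finset.sum_sub_distrib, Finset.sum_range_succ', Finset.sum_range_succ']
  simp only [← smul_sub]
  have hsum : ∑ k ∈ Finset.range n, (1 / ((k + 1 + 1).factorial : ℚ)) •
      (X ^ (k + 2) - Y ^ (k + 2)) ≡ 0 [SMOD degreeFiltration V (n + 2)] :=
    SModEq.zero.mpr (Submodule.sum_mem _ fun k _ =>
      Submodule.smul_mem _ _ (SModEq.sub_mem.mp (hpow k)))
  simpa [pow_succ] using hsum.add (SModEq.refl (X - Y))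

theorem smodEq_of_expT_smodEq {N : ℕ} {X Y : CompletedTensorAlgebra V} (hX : comp 0 X = 0)
    (hY : comp 0 Y = 0) (h : expT X ≡ expT Y [SMOD degreeFiltration V N]) :
    X ≡ Y [SMOD degreeFiltration V N] := by
  induction N with
  | zero => exact SModEq.sub_mem.mpr (mem_degreeFiltration_zero (X - Y))
  | succ N ih =>
    have hN := ih (h.mono (degreeFiltration_antitone N.le_succ))
    cases N with
    | zero =>
      exact SModEq.sub_mem.mpr (mem_degreeFiltration_one.mpr (by rw [comp_sub, hX, hY, sub_zero]))
    | succ N =>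
      exact sub_smodEq_zero.mp
        ((expT_sub_expT_smodEq hX hN).symm.trans (sub_smodEq_zero.mpr h))

theorem expT_injOn : Set.InjOn (expT (V := V)) {X | comp 0 X = 0} :=
  fun _ hX _ hY h => eq_of_forall_smodEq fun _ => smodEq_of_expT_smodEq hX hY (h ▸ SModEq.rfl)

theorem comp_one_expT {X : CompletedTensorAlgebra V} (hX : comp 0 X = 0) :
    comp 1 (expT X) = comp 1 X := by
  have h := expT_sub_expT_smodEq (n := 0) hX (SModEq.zero.mpr (mem_degreeFiltration_one.mpr hX))
  simpa [expT_zero, comp_one] using comp_eq_of_smodEq h one_lt_two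

end ExpLog

section Hausdorff

variable {V : Type*} [AddCommGroup V] [Module ℚ V]

theorem expT_add_hausdorff (X Y : CompletedTensorAlgebra V) :
    expT (X + Y + hausdorff X Y) = expT X * expT Y := by
  rw [hausdorff, sub_sub, add_sub_cancel, expT_logT]
  rw [comp_zero_mul, comp_zero_expT, comp_zero_expT, one_mul]

theorem comp_zero_add_hausdorff (X Y : CompletedTensorAlgebra V) :
    comp 0 (X + Y + hausdorff X Y) = 0 := by
  rw [hausdorff, sub_sub, add_sub_cancel, comp_zero_logT]

theorem hausdorff_zero : hausdorff (0 : CompletedTensorAlgebra V) 0 = 0 := by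
  refine expT_injOn (by simpa using comp_zero_add_hausdorff (V := V) 0 0) (comp_zero 0) ?_
  simpa [expT_zero] using expT_add_hausdorff (V := V) 0 0

theorem hausdorff_smodEq {n : ℕ} {X X' Y Y' : CompletedTensorAlgebra V} (hX : comp 0 X = 0)
    (hY : comp 0 Y = 0) (hXX : X ≡ X' [SMOD degreeFiltration V (n + 1)])
    (hYY : Y ≡ Y' [SMOD degreeFiltration V (n + 1)]) :
    hausdorff X Y ≡ hausdorff X' Y' [SMOD degreeFiltration V (n + 2)] := by
  have hx := expT_sub_expT_smodEq hX hXX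
  have hy := expT_sub_expT_smodEq hY hYY
  have hxmem : expT X - expT X' ∈ degreeFiltration V (n + 1) := SModEq.zero.mp
    ((hx.mono (degreeFiltration_antitone (n + 1).le_succ)).trans (sub_smodEq_zero.mpr hXX))
  have hymem : expT Y - expT Y' ∈ degreeFiltration V (n + 1) := SModEq.zero.mp
    ((hy.mono (degreeFiltration_antitone (n + 1).le_succ)).trans (sub_smodEq_zero.mpr hYY))
  set Z := X + Y + hausdorff X Y with hZ
  set Z' := X' + Y' + hausdorff X' Y' with hZ'
  have hZ0 : comp 0 Z = 0 := comp_zero_add_hausdorff X Y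
  have hexp : expT Z ≡ expT Z' [SMOD degreeFiltration V (n + 1)] := by
    rw [expT_add_hausdorff, expT_add_hausdorff]
    exact smodEq_mul (SModEq.sub_mem.mpr hxmem) (SModEq.sub_mem.mpr hymem)
  have hdiff : Z - Z' ≡ X - X' + (Y - Y') [SMOD degreeFiltration V (n + 2)] :=
    calc Z - Z'
        ≡ expT Z - expT Z' [SMOD degreeFiltration V (n + 2)] :=
          (expT_sub_expT_smodEq hZ0 (smodEq_of_expT_smodEq hZ0
            (comp_zero_add_hausdorff X' Y') hexp)).symm
      _ = (expT X - expT X') * expT Y + expT X' * (expT Y - expT Y') := by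
          rw [expT_add_hausdorff, expT_add_hausdorff, sub_mul, mul_sub, sub_add_sub_cancel]
      _ ≡ expT X - expT X' + (expT Y - expT Y') [SMOD degreeFiltration V (n + 2)] :=
          (mul_smodEq_left hxmem (comp_zero_expT Y)).add
            (mul_smodEq_right hymem (comp_zero_expT X'))
      _ ≡ X - X' + (Y - Y') [SMOD degreeFiltration V (n + 2)] := hx.add hy
  rw [SModEq.sub_mem] at hdiff ⊢
  convert hdiff using 1
  rw [hZ, hZ']
  abel

theorem comp_one_hausdorff {X Y : CompletedTensorAlgebra V} (hX : comp 0 X = 0)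
    (hY : comp 0 Y = 0) : comp 1 (hausdorff X Y) = 0 := by
  have h := hausdorff_smodEq (n := 0) hX hY (SModEq.zero.mpr (mem_degreeFiltration_one.mpr hX))
    (SModEq.zero.mpr (mem_degreeFiltration_one.mpr hY))
  rw [comp_eq_of_smodEq h one_lt_two, hausdorff_zero, comp_zero]

theorem add_smodEq_expT_mul_expT_sub_one {n : ℕ} {X Y : CompletedTensorAlgebra V}
    (hX : comp 0 X = 0) (hY : comp 0 Y = 0)
    (h : expT X * expT Y ≡ 1 [SMOD degreeFiltration V (n + 1)]) :
    X + Y ≡ expT X * expT Y - 1 [SMOD degreeFiltration V (n + 2)] := by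
  have hY' : comp 0 (-Y) = 0 := by rw [comp_neg, hY, neg_zero]
  have hdiff : expT X - expT (-Y) ≡ expT X * expT Y - 1 [SMOD degreeFiltration V (n + 2)] := by
    rw [show expT X - expT (-Y) = (expT X * expT Y - 1) * expT (-Y) by
      rw [sub_mul, mul_assoc, expT_mul_expT_neg hY, mul_one, one_mul]]
    exact mul_smodEq_left (SModEq.sub_mem.mp h) (comp_zero_expT _)
  have hXY : X ≡ -Y [SMOD degreeFiltration V (n + 1)] :=
    smodEq_of_expT_smodEq hX hY' (sub_smodEq_zero.mp
      ((hdiff.mono (degreeFiltration_antitone (n + 1).le_succ)).trans (sub_smodEq_zero.mpr h)))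
  simpa only [sub_neg_eq_add] using (expT_sub_expT_smodEq hX hXY).symm.trans hdiff

theorem add_hausdorff_smodEq {n : ℕ} {X Y Z : CompletedTensorAlgebra V} (hZ : comp 0 Z = 0)
    (h : expT X * expT Y * expT Z ≡ 1 [SMOD degreeFiltration V (n + 1)]) :
    X + Y + hausdorff X Y + Z ≡ expT X * expT Y * expT Z - 1
      [SMOD degreeFiltration V (n + 2)] := by
  rw [← expT_add_hausdorff] at h ⊢
  exact add_smodEq_expT_mul_expT_sub_one (comp_zero_add_hausdorff X Y) hZ h

theorem expT_mul_rotate_smodEq {n : ℕ} {X Y Z : CompletedTensorAlgebra V} (hX : comp 0 X = 0)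
    (h : expT X * expT Y * expT Z ≡ 1 [SMOD degreeFiltration V n]) :
    expT Y * expT Z * expT X - 1 ≡ expT X * expT Y * expT Z - 1
      [SMOD degreeFiltration V (n + 1)] := by
  rw [SModEq.sub_mem] at h
  have hconj : expT Y * expT Z * expT X - 1 =
      expT (-X) * (expT X * expT Y * expT Z - 1) * expT X := by
    simp only [mul_sub, sub_mul, mul_one, ← mul_assoc, expT_neg_mul_expT hX, one_mul]
  rw [hconj]
  exact (mul_smodEq_left (mul_mem_degreeFiltration_right _ h) (comp_zero_expT X)).trans
    (mul_smodEq_right h (comp_zero_expT _))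

theorem hausdorff_rotate_smodEq {n : ℕ} {X Y Z : CompletedTensorAlgebra V} (hX : comp 0 X = 0)
    (hZ : comp 0 Z = 0) (h : expT X * expT Y * expT Z ≡ 1 [SMOD degreeFiltration V (n + 1)]) :
    hausdorff Y Z ≡ hausdorff X Y [SMOD degreeFiltration V (n + 2)] := by
  have hrot := expT_mul_rotate_smodEq hX h
  have h' : expT Y * expT Z * expT X ≡ 1 [SMOD degreeFiltration V (n + 1)] :=
    sub_smodEq_zero.mp ((hrot.mono (degreeFiltration_antitone (n + 1).le_succ)).trans
      (sub_smodEq_zero.mpr h))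
  have hsum := (add_hausdorff_smodEq hX h').trans (hrot.trans (add_hausdorff_smodEq hZ h).symm)
  rw [SModEq.sub_mem] at hsum ⊢
  convert hsum using 1
  abel

end Hausdorff

section Naturality

variable {V W : Type*} [AddCommGroup V] [Module ℚ V] [AddCommGroup W] [Module ℚ W]

@[simp]
theorem comp_completedTensorMap (f : V →ₗ[ℚ] W) (n : ℕ) (X : CompletedTensorAlgebra V) :
    comp n (completedTensorMap f X) = tensorMap f (comp n X) :=
  comp_ofComp _ _ _

/-- The map induced by a linear map on completed tensor algebras, as an algebra homomorphism. -/
noncomputable def completedTensorHom (f : V →ₗ[ℚ] W) :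
    CompletedTensorAlgebra V →ₐ[ℚ] CompletedTensorAlgebra W :=
  AlgHom.ofLinearMap
    { toFun := completedTensorMap f
      map_add' := fun X Y => ext_comp fun n => by simp
      map_smul' := fun c X => ext_comp fun n => by simp }
    (ext_comp fun n => by simp [comp_one, apply_ite])
    (fun X Y => ext_comp fun n => by simp [comp_mul])

theorem comp_completedTensorHom (f : V →ₗ[ℚ] W) (n : ℕ) (X : CompletedTensorAlgebra V) :
    comp n (completedTensorHom f X) = tensorMap f (comp n X) :=
  comp_completedTensorMap f n X

theorem completedTensorHom_evalSeries (f : V →ₗ[ℚ] W) (c : ℕ → ℚ)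
    (X : CompletedTensorAlgebra V) :
    completedTensorHom f (evalSeries c X) = evalSeries c (completedTensorHom f X) :=
  ext_comp fun n => by
    simp only [evalSeries, comp_ofComp, comp_completedTensorHom, map_sum, map_smul, ← map_pow]

theorem completedTensorHom_expT (f : V →ₗ[ℚ] W) (X : CompletedTensorAlgebra V) :
    completedTensorHom f (expT X) = expT (completedTensorHom f X) :=
  completedTensorHom_evalSeries f _ X

theorem completedTensorHom_hausdorff (f : V →ₗ[ℚ] W) (X Y : CompletedTensorAlgebra V) :
    completedTensorHom f (hausdorff X Y) =
      hausdorff (completedTensorHom f X) (completedTensorHom f Y) := by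
  simp only [hausdorff, logT, map_sub, completedTensorHom_evalSeries, map_mul, map_one,
    completedTensorHom_expT]

end Naturality

/-! ### The Baker–Campbell–Hausdorff theorem -/

section Conjugation

variable {R : Type*} [Ring R]

/-- The operator `W ↦ [W, Y]`; the commutator is taken on this side because
`exp (-Y) W exp Y = ∑ (adRight Y)^n W / n!`. -/
def adRight (Y W : R) : R := W * Y - Y * W

variable [Algebra ℚ R]

theorem iterate_adRight (Y W : R) (n : ℕ) :
    (adRight Y)^[n] W =
      ((LinearMap.mulLeft ℚ (-Y) + LinearMap.mulRight ℚ Y) ^ n : Module.End ℚ R) W := by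
  have had : adRight Y = (LinearMap.mulLeft ℚ (-Y) + LinearMap.mulRight ℚ Y : Module.End ℚ R) := by
    funext X
    simp only [adRight, LinearMap.add_apply, LinearMap.mulLeft_apply, LinearMap.mulRight_apply]
    noncomm_ring
  rw [Module.End.pow_apply, had]

theorem sum_antidiagonal_conj (Y W : R) (n : ℕ) :
    ∑ p ∈ antidiagonal n,
      ((1 / (p.1.factorial : ℚ)) • (-Y) ^ p.1) * W * ((1 / (p.2.factorial : ℚ)) • Y ^ p.2) =
      (1 / (n.factorial : ℚ)) • (adRight Y)^[n] W := by
  have hcomm : Commute (LinearMap.mulLeft ℚ (-Y)) (LinearMap.mulRight ℚ Y) :=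
    LinearMap.commute_mulLeft_right (-Y) Y
  rw [iterate_adRight, hcomm.add_pow', LinearMap.sum_apply, Finset.smul_sum]
  refine Finset.sum_congr rfl fun p hp => ?_
  obtain rfl := mem_antidiagonal.mp hp
  rw [LinearMap.pow_mulLeft, LinearMap.pow_mulRight, LinearMap.smul_apply, Module.End.mul_apply,
    LinearMap.mulLeft_apply, LinearMap.mulRight_apply, ← Nat.cast_smul_eq_nsmul ℚ, smul_smul,
    smul_mul_assoc, smul_mul_assoc, mul_smul_comm, smul_smul, mul_assoc, Nat.cast_add_choose]
  congr 1
  field_simp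

end Conjugation

section Euler

variable {V : Type*} [AddCommGroup V] [Module ℚ V]

variable (V) in
/-- The Euler derivation, which multiplies the component of degree `n` by `n`. -/
noncomputable def euler : CompletedTensorAlgebra V →ₗ[ℚ] CompletedTensorAlgebra V where
  toFun X := ofComp (fun n => (n : ℚ) • comp n X) fun n => Submodule.smul_mem _ _ (comp_mem n X)
  map_add' X Y := ext_comp fun n => by simp
  map_smul' c X := ext_comp fun n => by simp [smul_smul, mul_comm]

@[simp]
theorem comp_euler (n : ℕ) (X : CompletedTensorAlgebra V) :
    comp n (euler V X) = (n : ℚ) • comp n X :=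
  comp_ofComp n (fun n => (n : ℚ) • comp n X) fun n => Submodule.smul_mem _ _ (comp_mem n X)

theorem euler_mul (X Y : CompletedTensorAlgebra V) :
    euler V (X * Y) = euler V X * Y + X * euler V Y := by
  refine ext_comp fun n => ?_
  rw [comp_euler, comp_add, comp_mul, comp_mul, comp_mul, ← Finset.sum_add_distrib,
    Finset.smul_sum]
  refine Finset.sum_congr rfl fun p hp => ?_
  rw [comp_euler, comp_euler, smul_mul_assoc, mul_smul_comm, ← add_smul, ← mem_antidiagonal.mp hp,
    Nat.cast_add]

theorem euler_one : euler V 1 = 0 := by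
  refine ext_comp fun n => ?_
  rw [comp_euler, comp_one]
  split_ifs with h <;> simp [h]

theorem euler_mem_degreeFiltration {N : ℕ} {X : CompletedTensorAlgebra V}
    (hX : X ∈ degreeFiltration V N) : euler V X ∈ degreeFiltration V N := fun n hn => by
  rw [comp_euler, hX n hn, smul_zero]

theorem euler_sumT (a : ℕ → CompletedTensorAlgebra V) :
    euler V (sumT a) = sumT fun k => euler V (a k) :=
  ext_comp fun n => by simp [sumT, Finset.smul_sum]

theorem iterate_adRight_mem_degreeFiltration {Y W : CompletedTensorAlgebra V} {m : ℕ}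
    (hY : comp 0 Y = 0) (hW : W ∈ degreeFiltration V m) (n : ℕ) :
    (adRight Y)^[n] W ∈ degreeFiltration V (m + n) := by
  have hY1 := mem_degreeFiltration_one.mpr hY
  induction n with
  | zero => exact hW
  | succ n ih =>
    rw [Function.iterate_succ_apply', ← add_assoc]
    exact sub_mem (mul_mem_degreeFiltration ih hY1)
      (add_comm 1 (m + n) ▸ mul_mem_degreeFiltration hY1 ih)

theorem expT_conj {Y : CompletedTensorAlgebra V} (hY : comp 0 Y = 0)
    (W : CompletedTensorAlgebra V) :
    expT (-Y) * W * expT Y = sumT fun n => (1 / (n.factorial : ℚ)) • (adRight Y)^[n] W := by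
  have hY' : comp 0 (-Y) = 0 := by rw [comp_neg, hY, neg_zero]
  have hterm := smul_pow_mem_degreeFiltration hY fun k => 1 / (k.factorial : ℚ)
  have hterm' := smul_pow_mem_degreeFiltration hY' fun k => 1 / (k.factorial : ℚ)
  rw [expT, expT, evalSeries_eq_sumT, evalSeries_eq_sumT, sumT_mul_right hterm',
    sumT_mul (fun k => mul_mem_degreeFiltration_left (hterm' k) W) hterm]
  exact congrArg sumT (funext (sum_antidiagonal_conj Y W))

/-- The logarithmic derivative `exp (-X) E (exp X)` of `exp` with respect to the Euler
derivation `E`. -/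
noncomputable def logDeriv (X : CompletedTensorAlgebra V) : CompletedTensorAlgebra V :=
  expT (-X) * euler V (expT X)

-- In `End T̂` the commutator of the Euler derivation with left multiplication by `Z` is left
-- multiplication by `euler V Z`, so that `logDeriv Z = exp (-Z) E exp Z - E` applied to `1`.
theorem iterate_succ_adRight_mulLeft_euler (Z : CompletedTensorAlgebra V) (n : ℕ) :
    (adRight (LinearMap.mulLeft ℚ Z : Module.End ℚ (CompletedTensorAlgebra V)))^[n + 1]
      (euler V) = LinearMap.mulLeft ℚ ((adRight Z)^[n] (euler V Z)) := by
  induction n with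
  | zero =>
    ext1 X
    change euler V (Z * X) - Z * euler V X = euler V Z * X
    rw [euler_mul, add_sub_cancel_right]
  | succ n ih =>
    rw [Function.iterate_succ_apply', ih, Function.iterate_succ_apply']
    ext1 X
    simp only [adRight, LinearMap.sub_apply, Module.End.mul_apply, LinearMap.mulLeft_apply,
      sub_mul, mul_assoc]

theorem logDeriv_eq_sumT_adRight_mulLeft {Z : CompletedTensorAlgebra V} (hZ : comp 0 Z = 0) :
    logDeriv Z = sumT fun n => (1 / (n.factorial : ℚ)) •
      ((adRight (LinearMap.mulLeft ℚ Z : Module.End ℚ (CompletedTensorAlgebra V)))^[n]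
        (euler V)) 1 := by
  have hZ' : comp 0 (-Z) = 0 := by rw [comp_neg, hZ, neg_zero]
  have hneg : -LinearMap.mulLeft ℚ Z = LinearMap.mulLeft ℚ (-Z) :=
    LinearMap.ext fun X => (neg_mul Z X).symm
  have hterm := smul_pow_mem_degreeFiltration hZ fun k => 1 / (k.factorial : ℚ)
  have hterm' := smul_pow_mem_degreeFiltration hZ' fun k => 1 / (k.factorial : ℚ)
  rw [logDeriv, expT, expT, evalSeries_eq_sumT, evalSeries_eq_sumT, euler_sumT,
    sumT_mul hterm' fun k => euler_mem_degreeFiltration (hterm k)]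
  congr 1 with n : 1
  rw [← LinearMap.smul_apply, ← sum_antidiagonal_conj, LinearMap.sum_apply, hneg]
  refine Finset.sum_congr rfl fun p _ => ?_
  rw [Module.End.mul_apply, Module.End.mul_apply, LinearMap.smul_apply, LinearMap.smul_apply,
    LinearMap.pow_mulLeft, LinearMap.pow_mulLeft, LinearMap.mulLeft_apply, LinearMap.mulLeft_apply,
    mul_one, smul_mul_assoc]

theorem logDeriv_eq_sumT {Z : CompletedTensorAlgebra V} (hZ : comp 0 Z = 0) :
    logDeriv Z =
      sumT fun n => (1 / ((n + 1).factorial : ℚ)) • (adRight Z)^[n] (euler V Z) := by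
  have hsucc : ∀ n, ((adRight (LinearMap.mulLeft ℚ Z :
      Module.End ℚ (CompletedTensorAlgebra V)))^[n + 1] (euler V)) 1 =
      (adRight Z)^[n] (euler V Z) := fun n => by
    rw [iterate_succ_adRight_mulLeft_euler, LinearMap.mulLeft_apply, mul_one]
  rw [logDeriv_eq_sumT_adRight_mulLeft hZ, sumT_eq_head_add fun n => Submodule.smul_mem _ _ ?_]
  · simp only [hsucc]
    simp [euler_one]
  · cases n with
    | zero => exact mem_degreeFiltration_zero _
    | succ n =>
      rw [hsucc, add_comm]
      exact iterate_adRight_mem_degreeFiltration hZ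
        (euler_mem_degreeFiltration (mem_degreeFiltration_one.mpr hZ)) n

theorem expT_neg_add_hausdorff {X Y : CompletedTensorAlgebra V} (hX : comp 0 X = 0)
    (hY : comp 0 Y = 0) : expT (-(X + Y + hausdorff X Y)) = expT (-Y) * expT (-X) := by
  refine left_inv_eq_right_inv (expT_neg_mul_expT (comp_zero_add_hausdorff X Y)) ?_
  rw [expT_add_hausdorff, mul_assoc, ← mul_assoc (expT Y), expT_mul_expT_neg hY, one_mul,
    expT_mul_expT_neg hX]

theorem logDeriv_add_hausdorff {X Y : CompletedTensorAlgebra V} (hX : comp 0 X = 0)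
    (hY : comp 0 Y = 0) :
    logDeriv (X + Y + hausdorff X Y) = expT (-Y) * logDeriv X * expT Y + logDeriv Y := by
  rw [logDeriv, expT_neg_add_hausdorff hX hY, expT_add_hausdorff, euler_mul, logDeriv, logDeriv,
    mul_add]
  congr 1
  · simp only [mul_assoc]
  · rw [mul_assoc, ← mul_assoc (expT (-X)), expT_neg_mul_expT hX, one_mul]

end Euler

section Lie

variable {V : Type*} [AddCommGroup V] [Module ℚ V]

attribute [local instance] LieRing.ofAssociativeRing in
theorem commutator_mem_freeLie {x y : TensorAlgebra ℚ V} (hx : x ∈ freeLie V)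
    (hy : y ∈ freeLie V) : x * y - y * x ∈ freeLie V :=
  (LieSubalgebra.lieSpan ℚ (TensorAlgebra ℚ V)
    (Set.range (TensorAlgebra.ι ℚ : V → TensorAlgebra ℚ V))).lie_mem hx hy

attribute [local instance] LieRing.ofAssociativeRing in
theorem ι_mem_freeLie (v : V) : TensorAlgebra.ι ℚ v ∈ freeLie V :=
  LieSubalgebra.subset_lieSpan ⟨v, rfl⟩

variable (V) in
/-- The elements without constant term whose components of degree less than `N` lie in the free
Lie algebra: the truncations of Lie series, over which statements on Lie series are proved by
induction on the degree. -/
noncomputable def lieBelow (N : ℕ) : Submodule ℚ (CompletedTensorAlgebra V) where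
  carrier := {X | comp 0 X = 0 ∧ ∀ n < N, comp n X ∈ freeLie V}
  add_mem' hX hY := ⟨by rw [comp_add, hX.1, hY.1, add_zero], fun n hn => by
    rw [comp_add]; exact add_mem (hX.2 n hn) (hY.2 n hn)⟩
  zero_mem' := ⟨comp_zero 0, fun n _ => by rw [comp_zero]; exact zero_mem _⟩
  smul_mem' c X hX := ⟨by rw [comp_smul, hX.1, smul_zero], fun n hn => by
    rw [comp_smul]; exact Submodule.smul_mem _ _ (hX.2 n hn)⟩

theorem lieBelow_antitone : Antitone (lieBelow V) :=
  fun _ _ h _ hX => ⟨hX.1, fun n hn => hX.2 n (hn.trans_le h)⟩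

theorem euler_mem_lieBelow {N : ℕ} {X : CompletedTensorAlgebra V} (hX : X ∈ lieBelow V N) :
    euler V X ∈ lieBelow V N :=
  ⟨by rw [comp_euler, hX.1, smul_zero], fun n hn => by
    rw [comp_euler]; exact Submodule.smul_mem _ _ (hX.2 n hn)⟩

theorem adRight_mem_lieBelow {N : ℕ} {X Y : CompletedTensorAlgebra V} (hX : X ∈ lieBelow V N)
    (hY : Y ∈ lieBelow V N) : adRight Y X ∈ lieBelow V (N + 1) := by
  refine ⟨by simp [adRight, comp_zero_mul, hX.1], fun n hn => ?_⟩
  rw [adRight, comp_sub, comp_mul, comp_mul,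
    ← Finset.Nat.sum_antidiagonal_swap (n := n) (f := fun p => comp p.1 Y * comp p.2 X),
    ← Finset.sum_sub_distrib]
  refine sum_mem fun p hp => ?_
  change comp p.1 X * comp p.2 Y - comp p.2 Y * comp p.1 X ∈ _
  have hsum := mem_antidiagonal.mp hp
  rcases Nat.eq_zero_or_pos p.1 with h1 | h1
  · rw [h1, hX.1, zero_mul, mul_zero, sub_zero]
    exact zero_mem _
  rcases Nat.eq_zero_or_pos p.2 with h2 | h2
  · rw [h2, hY.1, zero_mul, mul_zero, sub_zero]
    exact zero_mem _
  exact commutator_mem_freeLie (hX.2 _ (by omega)) (hY.2 _ (by omega))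

theorem iterate_succ_adRight_mem_lieBelow {N : ℕ} {X Y : CompletedTensorAlgebra V}
    (hX : X ∈ lieBelow V N) (hY : Y ∈ lieBelow V N) (k : ℕ) :
    (adRight Y)^[k + 1] X ∈ lieBelow V (N + 1) := by
  induction k with
  | zero => exact adRight_mem_lieBelow hX hY
  | succ k ih =>
    rw [Function.iterate_succ_apply']
    exact adRight_mem_lieBelow (lieBelow_antitone N.le_succ ih) hY

theorem iterate_adRight_mem_lieBelow {N : ℕ} {X Y : CompletedTensorAlgebra V}
    (hX : X ∈ lieBelow V N) (hY : Y ∈ lieBelow V N) :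
    ∀ k, (adRight Y)^[k] X ∈ lieBelow V N
  | 0 => hX
  | k + 1 => lieBelow_antitone N.le_succ (iterate_succ_adRight_mem_lieBelow hX hY k)

theorem sumT_mem_lieBelow {N : ℕ} {a : ℕ → CompletedTensorAlgebra V}
    (ha : ∀ k, a k ∈ lieBelow V N) : sumT a ∈ lieBelow V N := by
  refine ⟨?_, fun n hn => ?_⟩ <;> rw [sumT, comp_ofComp]
  · exact Finset.sum_eq_zero fun k _ => (ha k).1
  · exact sum_mem fun k _ => (ha k).2 n hn

theorem logDeriv_mem_lieBelow {N : ℕ} {X : CompletedTensorAlgebra V} (hX : X ∈ lieBelow V N) :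
    logDeriv X ∈ lieBelow V N := by
  rw [logDeriv_eq_sumT hX.1]
  exact sumT_mem_lieBelow fun k =>
    Submodule.smul_mem _ _ (iterate_adRight_mem_lieBelow (euler_mem_lieBelow hX) hX k)

theorem mem_lieBelow_of_logDeriv_mem {N : ℕ} {Z : CompletedTensorAlgebra V} (hZ : comp 0 Z = 0)
    (h : logDeriv Z ∈ lieBelow V N) : Z ∈ lieBelow V N := by
  induction N with
  | zero => exact ⟨hZ, fun n hn => absurd hn n.not_lt_zero⟩
  | succ m ih =>
    have hZm := ih (lieBelow_antitone m.le_succ h)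
    refine ⟨hZ, fun n hn => ?_⟩
    obtain hn | rfl := Nat.lt_succ_iff_lt_or_eq.mp hn
    · exact hZm.2 n hn
    rcases Nat.eq_zero_or_pos n with rfl | hn0
    · rw [hZ]
      exact zero_mem _
    -- In `logDeriv Z = E Z + [E Z, Z] / 2 + ⋯` only the first term involves `comp n Z` in degree
    -- `n`.
    have hlog := h.2 n n.lt_succ_self
    rw [logDeriv_eq_sumT hZ, sumT, comp_ofComp, Finset.sum_range_succ'] at hlog
    have hhigher : ∑ k ∈ Finset.range n, comp n ((1 / ((k + 1 + 1).factorial : ℚ)) •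
        (adRight Z)^[k + 1] (euler V Z)) ∈ freeLie V := sum_mem fun k _ => by
      rw [comp_smul]
      exact Submodule.smul_mem _ _ ((iterate_succ_adRight_mem_lieBelow
        (euler_mem_lieBelow hZm) hZm k).2 n n.lt_succ_self)
    have hfirst := (Submodule.add_mem_iff_right _ hhigher).mp hlog
    rw [comp_smul, Function.iterate_zero_apply, comp_euler, smul_smul] at hfirst
    exact (Submodule.smul_mem_iff _ (by simpa using hn0.ne')).mp hfirst

theorem hausdorff_mem_lieBelow {N : ℕ} {X Y : CompletedTensorAlgebra V} (hX : X ∈ lieBelow V N)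
    (hY : Y ∈ lieBelow V N) : hausdorff X Y ∈ lieBelow V N := by
  have hlog : logDeriv (X + Y + hausdorff X Y) ∈ lieBelow V N := by
    rw [logDeriv_add_hausdorff hX.1 hY.1, expT_conj hY.1]
    exact add_mem (sumT_mem_lieBelow fun k => Submodule.smul_mem _ _
      (iterate_adRight_mem_lieBelow (logDeriv_mem_lieBelow hX) hY k)) (logDeriv_mem_lieBelow hY)
  exact (Submodule.add_mem_iff_right _ (add_mem hX hY)).mp
    (mem_lieBelow_of_logDeriv_mem (comp_zero_add_hausdorff X Y) hlog)

end Lie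

/-! ### The boundary cycle -/

namespace BorderedFatgraph

section BoundaryCycle

variable (G : BorderedFatgraph.{u})

open Classical in
/-- The number of steps that lead along the boundary cycle from the tail to `x`: the boundary cycle
is cut at the univalent vertex, so that `tail` comes first and `bar tail` last. -/
noncomputable def position (x : G.E) : ℕ := Nat.find (G.exists_boundary_pow G.tail x)

theorem boundary_pow_position (x : G.E) : (G.boundary ^ G.position x) G.tail = x := by
  classical exact Nat.find_spec (G.exists_boundary_pow G.tail x)

variable {G} in
theorem position_le {x : G.E} {k : ℕ} (h : (G.boundary ^ k) G.tail = x) : G.position x ≤ k := by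
  classical exact Nat.find_min' (G.exists_boundary_pow G.tail x) h

theorem position_injective : Function.Injective G.position := fun x y h => by
  rw [← G.boundary_pow_position x, h, G.boundary_pow_position]

theorem boundary_apply (x : G.E) : G.boundary x = G.bar (G.next x) := rfl

theorem boundary_bar_tail : G.boundary (G.bar G.tail) = G.tail := by
  rw [boundary_apply, G.univalent, G.bar_bar]

theorem boundary_pow_last_succ :
    (G.boundary ^ (G.position (G.bar G.tail) + 1)) G.tail = G.tail := by
  rw [pow_succ', Equiv.Perm.mul_apply, boundary_pow_position, boundary_bar_tail]

-- Two equal edges in the first round of the boundary cycle would make the cycle close up before it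
-- reaches `bar tail`.
theorem position_boundary_pow {i : ℕ} (hi : i ≤ G.position (G.bar G.tail)) :
    G.position ((G.boundary ^ i) G.tail) = i := by
  refine le_antisymm (position_le rfl) (not_lt.mp fun hlt => ?_)
  set j := G.position ((G.boundary ^ i) G.tail) with hj
  have hperiod : (G.boundary ^ (i - j)) G.tail = G.tail := by
    have hpos := G.boundary_pow_position ((G.boundary ^ i) G.tail)
    rw [← hj, ← Nat.add_sub_cancel' hlt.le, pow_add, Equiv.Perm.mul_apply] at hpos
    exact ((G.boundary ^ j).injective hpos).symm
  have hlast := G.boundary_pow_position (G.bar G.tail)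
  rw [← Nat.sub_add_cancel (show i - j ≤ G.position (G.bar G.tail) by omega), pow_add,
    Equiv.Perm.mul_apply, hperiod] at hlast
  have := position_le hlast
  omega

theorem position_le_last (x : G.E) : G.position x ≤ G.position (G.bar G.tail) := by
  by_contra! hlt
  have hpos := G.boundary_pow_position x
  rw [← Nat.sub_add_cancel (Nat.succ_le_of_lt hlt), pow_add, Equiv.Perm.mul_apply,
    Nat.succ_eq_add_one, boundary_pow_last_succ] at hpos
  have := position_le hpos
  omega

variable {G}

theorem position_lt_last {x : G.E} (hx : x ≠ G.bar G.tail) :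
    G.position x < G.position (G.bar G.tail) :=
  lt_of_le_of_ne (G.position_le_last x) fun h => hx (G.position_injective h)

theorem position_bar_next {x : G.E} (hx : x ≠ G.bar G.tail) :
    G.position (G.bar (G.next x)) = G.position x + 1 := by
  have hstep : G.bar (G.next x) = (G.boundary ^ (G.position x + 1)) G.tail := by
    rw [pow_succ', Equiv.Perm.mul_apply, boundary_pow_position, boundary_apply]
  rw [hstep, position_boundary_pow]
  exact position_lt_last hx

theorem next_ne_bar_tail {x : G.E} (hx : x ≠ G.bar G.tail) : G.next x ≠ G.bar G.tail :=
  fun h => hx (G.next.injective (h.trans G.univalent.symm))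

theorem path_eq (x : G.E) (i : ℕ) : G.path x i = (G.boundary ^ (G.position x + i)) G.tail := by
  rw [path, add_comm, pow_add, Equiv.Perm.mul_apply, boundary_pow_position]

theorem path_succ (x : G.E) (i : ℕ) : G.path x (i + 1) = G.bar (G.next (G.path x i)) := by
  rw [path, pow_succ', Equiv.Perm.mul_apply, boundary_apply, path]

theorem position_path {x : G.E} {i : ℕ} (h : G.position x + i ≤ G.position (G.bar G.tail)) :
    G.position (G.path x i) = G.position x + i := by
  rw [path_eq, position_boundary_pow _ h]

theorem path_pathLength (x : G.E) : G.path x (G.pathLength x) = G.bar x := by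
  classical exact Nat.find_spec (G.exists_boundary_pow x (G.bar x))

theorem pathLength_le {x : G.E} {k : ℕ} (h : G.path x k = G.bar x) : G.pathLength x ≤ k := by
  classical exact Nat.find_min' (G.exists_boundary_pow x (G.bar x)) h

theorem position_add_pathLength {x : G.E} (h : G.position x < G.position (G.bar x)) :
    G.position x + G.pathLength x = G.position (G.bar x) := by
  have hlast := G.position_le_last (G.bar x)
  have hpath : G.path x (G.position (G.bar x) - G.position x) = G.bar x := by
    rw [path_eq, Nat.add_sub_cancel' h.le, boundary_pow_position]
  have hle := pathLength_le hpath
  have hpos := position_path (x := x) (i := G.pathLength x) (by omega)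
  rw [path_pathLength] at hpos
  exact hpos.symm

theorem position_bar_ne (x : G.E) : G.position (G.bar x) ≠ G.position x :=
  fun h => G.bar_ne x (G.position_injective h)

theorem avoidsTail_iff {x : G.E} : G.AvoidsTail x ↔ G.position x < G.position (G.bar x) := by
  constructor
  · intro h
    by_contra hlt
    have hlast := G.position_le_last x
    have hne := position_bar_ne x
    refine h (G.position (G.bar G.tail) - G.position x) ?_ ?_
    · by_contra hlen
      have hpos := position_path (x := x) (i := G.pathLength x) (by omega)
      rw [path_pathLength] at hpos
      omega
    · rw [path_eq, Nat.add_sub_cancel' hlast, boundary_pow_position]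
  · intro h i hi heq
    have hlength := position_add_pathLength h
    have hlast := G.position_le_last (G.bar x)
    have hpos := position_path (x := x) (i := i) (by omega)
    rw [heq] at hpos
    omega

theorem avoidsTail_bar_iff {x : G.E} : G.AvoidsTail (G.bar x) ↔ ¬ G.AvoidsTail x := by
  rw [avoidsTail_iff, avoidsTail_iff, G.bar_bar, not_lt, le_iff_lt_or_eq,
    or_iff_left (position_bar_ne x)]

section CornerPotential

variable {M : Type*} [AddCommGroup M]

/-- The sum of a function `c` of the corners of the fatgraph along the boundary cycle from `tail`
to `x`. The corner between `y` and `next y`, which the boundary cycle passes in the step from `y`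
to `bar (next y)`, is recorded as `y`. -/
noncomputable def cornerPotential (c : G.E → M) (x : G.E) : M :=
  ∑ i ∈ Finset.range (G.position x), c ((G.boundary ^ i) G.tail)

theorem cornerPotential_bar_next (c : G.E → M) {x : G.E} (hx : x ≠ G.bar G.tail) :
    cornerPotential c (G.bar (G.next x)) = cornerPotential c x + c x := by
  rw [cornerPotential, position_bar_next hx, Finset.sum_range_succ, boundary_pow_position,
    cornerPotential]

theorem sum_path_eq_cornerPotential_sub (c : G.E → M) {x : G.E} (hx : G.AvoidsTail x) :
    ∑ i ∈ Finset.range (G.pathLength x), c (G.path x i) =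
      cornerPotential c (G.bar x) - cornerPotential c x := by
  rw [cornerPotential, ← position_add_pathLength (avoidsTail_iff.mp hx), Finset.sum_range_add,
    cornerPotential, add_sub_cancel_left]
  simp only [path_eq]

theorem eq_cornerPotential_sub {c S : G.E → M}
    (hpath : ∀ x, G.AvoidsTail x → S x = ∑ i ∈ Finset.range (G.pathLength x), c (G.path x i))
    (hbar : ∀ x, ¬ G.AvoidsTail x → S x = -S (G.bar x)) (x : G.E) :
    S x = cornerPotential c (G.bar x) - cornerPotential c x := by
  by_cases hx : G.AvoidsTail x
  · rw [hpath x hx, sum_path_eq_cornerPotential_sub c hx]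
  · have hx' := avoidsTail_bar_iff.mpr hx
    rw [hbar x hx, hpath _ hx', sum_path_eq_cornerPotential_sub c hx', G.bar_bar, neg_sub]

theorem sum_vertex_eq_sum_corners {c S : G.E → M}
    (hpath : ∀ x, G.AvoidsTail x → S x = ∑ i ∈ Finset.range (G.pathLength x), c (G.path x i))
    (hbar : ∀ x, ¬ G.AvoidsTail x → S x = -S (G.bar x)) {x : G.E} (hx : x ≠ G.bar G.tail) :
    S x + S (G.next x) + S (G.next (G.next x)) =
      c x + c (G.next x) + c (G.next (G.next x)) := by
  have hx1 := next_ne_bar_tail hx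
  have hclose := cornerPotential_bar_next c (next_ne_bar_tail hx1)
  rw [(G.trivalent x hx).2] at hclose
  simp only [eq_cornerPotential_sub hpath hbar]
  rw [hclose, cornerPotential_bar_next c hx, cornerPotential_bar_next c hx1]
  abel

end CornerPotential

end BoundaryCycle

/-! ### The recursion -/

section Recursion

variable {V : Type*} [AddCommGroup V] [Module ℚ V]

@[simp]
theorem comp_homogeneousPart (n k : ℕ) (X : CompletedTensorAlgebra V) :
    comp k (homogeneousPart n X) = if k = n then comp k X else 0 :=
  comp_ofComp k (fun k => if k = n then comp k X else 0) _

@[simp]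
theorem comp_ofDegreeOne (k : ℕ) (v : V) :
    comp k (ofDegreeOne v) = if k = 1 then TensorAlgebra.ι ℚ v else 0 :=
  comp_ofComp k (fun k => if k = 1 then TensorAlgebra.ι ℚ v else 0) _

variable {G : BorderedFatgraph.{u}}

theorem pathSum_smodEq {L L' : G.E → CompletedTensorAlgebra V} (h0 : ∀ x, comp 0 (L x) = 0)
    {n : ℕ} (h : ∀ x, L x ≡ L' x [SMOD degreeFiltration V (n + 1)]) (x : G.E) :
    G.pathSum L x ≡ G.pathSum L' x [SMOD degreeFiltration V (n + 2)] :=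
  SModEq.sum fun i _ =>
    hausdorff_smodEq (h0 _) (by rw [comp_neg, h0, neg_zero]) (h _) (h _).neg

theorem pathSum_mem_lieBelow {N : ℕ} {L : G.E → CompletedTensorAlgebra V}
    (h : ∀ x, L x ∈ lieBelow V N) (x : G.E) : G.pathSum L x ∈ lieBelow V N :=
  sum_mem fun _ _ => hausdorff_mem_lieBelow (h _) (neg_mem (h _))

section EllApprox

variable (m : G.E → V)

theorem comp_ellApprox_succ {n k : ℕ} (h : n ≤ k) (x : G.E) :
    comp n (G.ellApprox m (k + 1) x) = comp n (G.ellApprox m k x) := by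
  cases k with
  | zero =>
    obtain rfl := Nat.le_zero.mp h
    simp [ellApprox]
  | succ k => rw [ellApprox, comp_add, comp_homogeneousPart, if_neg (by omega), add_zero]

theorem comp_ellApprox_of_lt {n k : ℕ} (h : k < n) (x : G.E) :
    comp n (G.ellApprox m k x) = 0 := by
  match k with
  | 0 => exact comp_zero n
  | 1 => simp [ellApprox, h.ne']
  | k + 2 =>
    rw [ellApprox, comp_add, comp_ellApprox_of_lt (by omega), comp_homogeneousPart,
      if_neg (by omega), add_zero]

theorem comp_ell_eq {n k : ℕ} (h : n ≤ k) (x : G.E) :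
    comp n (G.ell m x) = comp n (G.ellApprox m k x) := by
  rw [ell, comp_ofComp]
  induction k, h using Nat.le_induction with
  | base => rfl
  | succ k hk ih => rw [ih, comp_ellApprox_succ m hk]

theorem ell_smodEq_ellApprox (n : ℕ) (x : G.E) :
    G.ell m x ≡ G.ellApprox m n x [SMOD degreeFiltration V (n + 1)] :=
  smodEq_degreeFiltration.mpr fun _ hk => comp_ell_eq m (Nat.lt_succ_iff.mp hk) x

theorem comp_zero_ell (x : G.E) : comp 0 (G.ell m x) = 0 := by
  rw [comp_ell_eq m le_rfl, ellApprox]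
  exact comp_zero 0

theorem comp_one_ell (x : G.E) : comp 1 (G.ell m x) = TensorAlgebra.ι ℚ (m x) := by
  rw [comp_ell_eq m le_rfl, ellApprox, comp_ofDegreeOne, if_pos rfl]

open Classical in
theorem comp_ell_add_two (n : ℕ) (x : G.E) :
    comp (n + 2) (G.ell m x) = if G.AvoidsTail x
      then (-(1 / 3 : ℚ)) • comp (n + 2) (G.pathSum (G.ell m) x)
      else (1 / 3 : ℚ) • comp (n + 2) (G.pathSum (G.ell m) (G.bar x)) := by
  have hpath : ∀ x, comp (n + 2) (G.pathSum (G.ell m) x) =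
      comp (n + 2) (G.pathSum (G.ellApprox m (n + 1)) x) := fun x =>
    comp_eq_of_smodEq (pathSum_smodEq (comp_zero_ell m) (ell_smodEq_ellApprox m (n + 1)) x)
      (n + 2).lt_succ_self
  rw [comp_ell_eq m le_rfl, ellApprox, comp_add, comp_ellApprox_of_lt m (n + 1).lt_succ_self,
    zero_add, comp_homogeneousPart, if_pos rfl, hpath, hpath]
  split_ifs <;> rw [comp_smul]

theorem solvesRecursion_ell : G.SolvesRecursion m (G.ell m) := by
  refine fun x => ⟨comp_zero_ell m x, comp_one_ell m x, fun n hn => ?_⟩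
  obtain ⟨n, rfl⟩ := Nat.exists_eq_add_of_le' hn
  refine ⟨fun hx => ?_, fun hx => ?_⟩
  · rw [comp_ell_add_two, if_pos hx, pathSum, comp_sum]
  · rw [comp_ell_add_two, comp_ell_add_two, if_neg hx, if_pos (avoidsTail_bar_iff.mpr hx),
      neg_smul, neg_neg]

theorem homogeneousPart_mem_lieBelow {N : ℕ} {X : CompletedTensorAlgebra V}
    (hX : X ∈ lieBelow V N) (n : ℕ) : homogeneousPart n X ∈ lieBelow V N := by
  refine ⟨by rw [comp_homogeneousPart, hX.1, ite_self], fun k hk => ?_⟩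
  rw [comp_homogeneousPart]
  split_ifs
  · exact hX.2 k hk
  · exact zero_mem _

theorem ofDegreeOne_mem_lieBelow (N : ℕ) (v : V) : ofDegreeOne v ∈ lieBelow V N := by
  refine ⟨by simp, fun n _ => ?_⟩
  rw [comp_ofDegreeOne]
  split_ifs
  · exact ι_mem_freeLie v
  · exact zero_mem _

theorem ellApprox_mem_lieBelow (N k : ℕ) (x : G.E) : G.ellApprox m k x ∈ lieBelow V N := by
  match k with
  | 0 => exact zero_mem _
  | 1 => exact ofDegreeOne_mem_lieBelow N (m x)
  | k + 2 =>
    have hpath := pathSum_mem_lieBelow (ellApprox_mem_lieBelow N (k + 1))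
    refine add_mem (ellApprox_mem_lieBelow N (k + 1) x) (homogeneousPart_mem_lieBelow ?_ _)
    split_ifs <;> exact Submodule.smul_mem _ _ (hpath _)

theorem comp_ell_mem_freeLie (n : ℕ) (x : G.E) : comp n (G.ell m x) ∈ freeLie V := by
  rw [comp_ell_eq m le_rfl]
  exact (ellApprox_mem_lieBelow m (n + 1) n x).2 n n.lt_succ_self

end EllApprox

namespace SolvesRecursion

variable {m : G.E → V} {L L' : G.E → CompletedTensorAlgebra V}

theorem comp_of_avoidsTail (h : G.SolvesRecursion m L) {x : G.E} (hx : G.AvoidsTail x) (n : ℕ) :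
    comp (n + 2) (L x) = (-(1 / 3 : ℚ)) • comp (n + 2) (G.pathSum L x) := by
  rw [((h x).2.2 _ (by omega)).1 hx, pathSum, comp_sum]

theorem comp_of_not_avoidsTail (h : G.SolvesRecursion m L) {x : G.E} (hx : ¬ G.AvoidsTail x)
    (n : ℕ) : comp (n + 2) (L x) = -comp (n + 2) (L (G.bar x)) :=
  ((h x).2.2 _ (by omega)).2 hx

theorem apply_bar (h : G.SolvesRecursion m L) (hm : ∀ x, m (G.bar x) = -m x) (x : G.E) :
    L (G.bar x) = -L x := by
  refine ext_comp fun n => ?_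
  rw [comp_neg]
  match n with
  | 0 => rw [(h _).1, (h _).1, neg_zero]
  | 1 => rw [(h _).2.1, (h _).2.1, hm, map_neg]
  | n + 2 =>
    by_cases hx : G.AvoidsTail x
    · rw [h.comp_of_not_avoidsTail (avoidsTail_bar_iff.not.mpr (not_not.mpr hx)), G.bar_bar]
    · rw [h.comp_of_not_avoidsTail hx, neg_neg]

theorem unique (h : G.SolvesRecursion m L) (h' : G.SolvesRecursion m L') : L = L' := by
  have hmod : ∀ n x, L x ≡ L' x [SMOD degreeFiltration V (n + 2)] := by
    intro n
    induction n with
    | zero =>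
      refine fun x => smodEq_degreeFiltration.mpr fun k hk => ?_
      interval_cases k
      · rw [(h x).1, (h' x).1]
      · rw [(h x).2.1, (h' x).2.1]
    | succ n ih =>
      have htop : ∀ x, G.AvoidsTail x → comp (n + 2) (L x) = comp (n + 2) (L' x) := fun x hx => by
        rw [h.comp_of_avoidsTail hx, h'.comp_of_avoidsTail hx,
          comp_eq_of_smodEq (pathSum_smodEq (fun x => (h x).1) ih x) (n + 2).lt_succ_self]
      refine fun x => smodEq_degreeFiltration.mpr fun k hk => ?_
      obtain hk | rfl := Nat.lt_succ_iff_lt_or_eq.mp hk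
      · exact comp_eq_of_smodEq (ih x) hk
      by_cases hx : G.AvoidsTail x
      · exact htop x hx
      · rw [h.comp_of_not_avoidsTail hx, h'.comp_of_not_avoidsTail hx,
          htop _ (avoidsTail_bar_iff.mpr hx)]
  exact funext fun x => ext_comp fun n => comp_eq_of_smodEq (hmod n x) (by omega)

theorem sum_comp_vertex (h : G.SolvesRecursion m L) (hm : ∀ x, m (G.bar x) = -m x) (n : ℕ)
    {x : G.E} (hx : x ≠ G.bar G.tail) :
    comp (n + 2) (L x) + comp (n + 2) (L (G.next x)) + comp (n + 2) (L (G.next (G.next x))) =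
      (-(1 / 3 : ℚ)) • (comp (n + 2) (hausdorff (L x) (L (G.next x))) +
        comp (n + 2) (hausdorff (L (G.next x)) (L (G.next (G.next x)))) +
        comp (n + 2) (hausdorff (L (G.next (G.next x))) (L x))) := by
  have hsum := sum_vertex_eq_sum_corners (S := fun x => comp (n + 2) (L x))
    (c := fun x => (-(1 / 3 : ℚ)) • comp (n + 2) (hausdorff (L x) (L (G.next x))))
    (fun x hx => ?_) (fun x hx => h.comp_of_not_avoidsTail hx n) hx
  · rw [smul_add, smul_add]
    simpa only [(G.trivalent x hx).2] using hsum
  · rw [h.comp_of_avoidsTail hx, pathSum, comp_sum, Finset.smul_sum]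
    simp only [path_succ, h.apply_bar hm, neg_neg]

-- By `hausdorff_rotate_smodEq` the three corners at a vertex contribute the same term, so the
-- factor `1 / 3` in the recursion makes the sum of the three values cancel one of them.
theorem comp_vertex_eq_zero (h : G.SolvesRecursion m L) (hm : ∀ x, m (G.bar x) = -m x)
    (hm' : ∀ x, x ≠ G.bar G.tail → m x + m (G.next x) + m (G.next (G.next x)) = 0) {n : ℕ}
    (hn : ∀ x, x ≠ G.bar G.tail →
      expT (L x) * expT (L (G.next x)) * expT (L (G.next (G.next x))) ≡ 1
        [SMOD degreeFiltration V (n + 1)]) {x : G.E} (hx : x ≠ G.bar G.tail) :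
    comp (n + 1) (L x + L (G.next x) + hausdorff (L x) (L (G.next x)) +
      L (G.next (G.next x))) = 0 := by
  have h0 : ∀ x, comp 0 (L x) = 0 := fun x => (h x).1
  have hrot : ∀ x, x ≠ G.bar G.tail →
      comp (n + 1) (hausdorff (L (G.next x)) (L (G.next (G.next x)))) =
        comp (n + 1) (hausdorff (L x) (L (G.next x))) := fun x hx =>
    comp_eq_of_smodEq (hausdorff_rotate_smodEq (h0 _) (h0 _) (hn x hx)) (n + 1).lt_succ_self
  simp only [comp_add, add_right_comm _ (comp (n + 1) (hausdorff _ _))]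
  cases n with
  | zero =>
    simp only [zero_add, comp_one_hausdorff (h0 _) (h0 _), (h _).2.1, add_zero]
    rw [← map_add, ← map_add, hm' x hx, map_zero]
  | succ n =>
    have hrot' := hrot _ (next_ne_bar_tail hx)
    rw [(G.trivalent x hx).2] at hrot'
    rw [h.sum_comp_vertex hm n hx, hrot', hrot x hx]
    module

theorem expT_vertex (h : G.SolvesRecursion m L) (hm : ∀ x, m (G.bar x) = -m x)
    (hm' : ∀ x, x ≠ G.bar G.tail → m x + m (G.next x) + m (G.next (G.next x)) = 0)
    {x : G.E} (hx : x ≠ G.bar G.tail) :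
    expT (L x) * expT (L (G.next x)) * expT (L (G.next (G.next x))) = 1 := by
  have hmod : ∀ n x, x ≠ G.bar G.tail →
      expT (L x) * expT (L (G.next x)) * expT (L (G.next (G.next x))) ≡ 1
        [SMOD degreeFiltration V (n + 1)] := by
    intro n
    induction n with
    | zero =>
      refine fun x _ => SModEq.sub_mem.mpr (mem_degreeFiltration_one.mpr ?_)
      simp only [comp_sub, comp_zero_mul, comp_zero_expT, mul_one, comp_one, if_true,
        sub_self]
    | succ n ih =>
      refine fun x hx => smodEq_degreeFiltration.mpr fun k hk => ?_
      obtain hk | rfl := Nat.lt_succ_iff_lt_or_eq.mp hk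
      · exact comp_eq_of_smodEq (ih x hx) hk
      rw [← sub_eq_zero, ← comp_sub, ← h.comp_vertex_eq_zero hm hm' ih hx]
      exact (comp_eq_of_smodEq (add_hausdorff_smodEq (h _).1 (ih x hx))
        (n + 1).lt_succ_self).symm
  exact eq_of_forall_smodEq fun n => (hmod n x hx).mono (degreeFiltration_antitone n.le_succ)

end SolvesRecursion

end Recursion

end BorderedFatgraph

/-! ### Finitely generated free groups are Hopfian -/

section Hopfian

theorem exists_perm_extending {X : Type*} (e : Equiv.Perm X) (S : Set X) [Finite S] :
    ∃ σ : Equiv.Perm S, ∀ s t : S, e s = t → σ s = t := by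
  classical
  have := Fintype.ofFinite S
  let partialPerm : {s : S // e s ∈ S} ≃ {t : S // e.symm t ∈ S} :=
    { toFun s := ⟨⟨e s.1, s.2⟩, by simp⟩
      invFun t := ⟨⟨e.symm t.1, t.2⟩, by simp⟩
      left_inv s := by simp
      right_inv t := by simp }
  refine ⟨partialPerm.extendSubtype, fun s t h => ?_⟩
  rw [Equiv.extendSubtype_apply_of_mem _ s (h ▸ t.2)]
  exact Subtype.ext h

theorem lift_mk_apply_one {α : Type*} {S : Set (FreeGroup α)} {σ : α → Equiv.Perm S}
    (hσ : ∀ a (s t : S), FreeGroup.of a * s.1 = t.1 → σ a s = t) {L : List (α × Bool)}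
    (hS : ∀ L', L' <:+ L → FreeGroup.mk L' ∈ S) :
    FreeGroup.lift σ (FreeGroup.mk L) ⟨FreeGroup.mk [], hS [] List.nil_suffix⟩ =
      ⟨FreeGroup.mk L, hS L List.suffix_rfl⟩ := by
  induction L with
  | nil => rfl
  | cons p L ih =>
    have hS' : ∀ L', L' <:+ L → FreeGroup.mk L' ∈ S := fun L' h =>
      hS L' (h.trans (List.suffix_cons p L))
    have hcons : FreeGroup.lift σ (FreeGroup.mk (p :: L)) =
        FreeGroup.lift σ (FreeGroup.mk [p]) * FreeGroup.lift σ (FreeGroup.mk L) := by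
      rw [← map_mul, FreeGroup.mul_mk, List.singleton_append]
    rw [hcons, Equiv.Perm.mul_apply, ih hS']
    obtain ⟨a, _ | _⟩ := p
    · have h : σ a ⟨FreeGroup.mk ((a, false) :: L), hS _ List.suffix_rfl⟩ =
          ⟨FreeGroup.mk L, hS' L List.suffix_rfl⟩ :=
        hσ a _ _ (mul_inv_cancel_left (FreeGroup.of a) (FreeGroup.mk L))
      simp [FreeGroup.lift_mk, ← h]
    · have h : σ a ⟨FreeGroup.mk L, hS' L List.suffix_rfl⟩ =
          ⟨FreeGroup.mk ((a, true) :: L), hS _ List.suffix_rfl⟩ := hσ a _ _ rfl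
      simp [FreeGroup.lift_mk, h]

-- The left translations by the generators extend from the finite set of suffixes of a word to
-- permutations, and these move `1` to the element represented by the word.
instance residuallyFinite_freeGroup {α : Type*} : Group.ResiduallyFinite (FreeGroup α) := by
  classical
  refine Group.residuallyFinite_of_forall_exists_finite_monoidHom fun w hw => ?_
  let S : Set (FreeGroup α) := FreeGroup.mk '' {L | L ∈ w.toWord.tails}
  have : Finite S := (List.finite_toSet w.toWord.tails).image _
  choose σ hσ using fun a : α => exists_perm_extending (Equiv.mulLeft (FreeGroup.of a)) S
  have hword := lift_mk_apply_one hσ (L := w.toWord) fun L hL =>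
    ⟨L, (List.mem_tails _ _).mpr hL, rfl⟩
  refine ⟨Equiv.Perm S, inferInstance, inferInstance, FreeGroup.lift σ, fun h => hw ?_⟩
  simp only [FreeGroup.mk_toWord, h, Equiv.Perm.one_apply] at hword
  exact congrArg Subtype.val hword.symm

theorem finite_monoidHom (G Q : Type*) [Group G] [Group.FG G] [Group Q] [Finite Q] :
    Finite (G →* Q) := by
  obtain ⟨S, hS, hfin⟩ := Group.fg_iff.mp ‹Group.FG G›
  have := hfin.to_subtype
  exact Finite.of_injective (fun (f : G →* Q) (s : S) => f s) fun f f' h =>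
    MonoidHom.eq_of_eqOn_dense hS fun s hs => congrFun h ⟨s, hs⟩

theorem injective_of_surjective_of_residuallyFinite {G : Type*} [Group G] [Group.FG G]
    [Group.ResiduallyFinite G] {f : G →* G} (hf : Function.Surjective f) :
    Function.Injective f := by
  refine (injective_iff_map_eq_one f).mpr fun w hw => by_contra fun hne => ?_
  obtain ⟨N, hN⟩ := Group.exists_finiteIndexNormalSubgroup_notMem w hne
  have := finite_monoidHom G (G ⧸ N.toSubgroup)
  have hinj : Function.Injective fun τ : G →* G ⧸ N.toSubgroup => τ.comp f :=
    fun τ τ' h => (MonoidHom.cancel_right hf).mp h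
  obtain ⟨τ, hτ⟩ := Finite.surjective_of_injective hinj (QuotientGroup.mk' N.toSubgroup)
  refine hN ((QuotientGroup.eq_one_iff w).mp ?_)
  rw [← QuotientGroup.mk'_apply, ← hτ, MonoidHom.comp_apply, hw, map_one]

theorem freeGroup_bijective_of_surjective {α β : Type*} [Finite α] (e : α ≃ β)
    {f : FreeGroup α →* FreeGroup β} (hf : Function.Surjective f) : Function.Bijective f := by
  let e' : FreeGroup β ≃* FreeGroup α := (FreeGroup.freeGroupCongr e).symm
  have hinj : Function.Injective (e'.toMonoidHom.comp f) :=
    injective_of_surjective_of_residuallyFinite (e'.surjective.comp hf)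
  exact ⟨Function.Injective.of_comp hinj, hf⟩

end Hopfian

/-! ### The spanning tree of first arrivals -/

namespace BorderedFatgraph

section SpanningTree

variable (G : BorderedFatgraph.{u})

/-- The vertices of a fatgraph. -/
abbrev Vertex : Type u := Quotient (Equiv.Perm.SameCycle.setoid G.next)

/-- The unoriented edges of a fatgraph. -/
abbrev Edge : Type u := Quotient (Equiv.Perm.SameCycle.setoid G.bar)

/-- The vertex into which an oriented edge points. -/
def target (x : G.E) : G.Vertex := Quotient.mk _ x

/-- The unoriented edge underlying an oriented edge. -/
def edge (x : G.E) : G.Edge := Quotient.mk _ x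

theorem target_next (x : G.E) : G.target (G.next x) = G.target x :=
  Quotient.sound (Equiv.Perm.sameCycle_apply_left.mpr (Equiv.Perm.SameCycle.refl _ _))

theorem edge_eq_iff {x y : G.E} : G.edge x = G.edge y ↔ y = x ∨ y = G.bar x := by
  constructor
  · intro h
    obtain ⟨i, rfl⟩ : G.bar.SameCycle x y := Quotient.exact h
    have hsq : G.bar ^ (2 : ℤ) = 1 := Equiv.ext fun z => by
      rw [zpow_two, Equiv.Perm.mul_apply, G.bar_bar, Equiv.Perm.one_apply]
    obtain ⟨k, rfl | rfl⟩ := Int.even_or_odd' i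
    · exact Or.inl (by rw [zpow_mul, hsq, one_zpow, Equiv.Perm.one_apply])
    · exact Or.inr (by rw [zpow_add, zpow_mul, hsq, one_zpow, one_mul, zpow_one])
  · rintro (rfl | rfl)
    · rfl
    · exact Quotient.sound (Equiv.Perm.sameCycle_apply_right.mpr (Equiv.Perm.SameCycle.refl _ _))

theorem target_surjective : Function.Surjective G.target := Quotient.mk_surjective

/-- The oriented edge along which the boundary cycle, started at the tail, first arrives at a
vertex. -/
noncomputable def firstArrival (q : G.Vertex) : G.E :=
  Function.argminOn G.position {x | G.target x = q} (G.target_surjective q)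

theorem target_firstArrival (q : G.Vertex) : G.target (G.firstArrival q) = q :=
  Function.argminOn_mem G.position {x | G.target x = q} (G.target_surjective q)

theorem position_firstArrival_le (x : G.E) :
    G.position (G.firstArrival (G.target x)) ≤ G.position x :=
  Function.argminOn_le G.position {y | G.target y = G.target x} rfl

variable {G}

-- The boundary cycle leaves a vertex only after it has arrived there.
theorem position_firstArrival_lt_bar {y : G.E} (hy : y ≠ G.bar G.tail) :
    G.position (G.firstArrival (G.target y)) < G.position (G.bar y) := by
  obtain ⟨x, rfl⟩ := G.next.surjective y
  have hx : x ≠ G.bar G.tail := fun h => hy (by rw [h, G.univalent])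
  rw [target_next, position_bar_next hx]
  exact Nat.lt_succ_of_le (G.position_firstArrival_le x)

variable (G) in
/-- The trivalent vertices: all vertices except the univalent one. -/
abbrev TrivalentVertex : Type u := {q : G.Vertex // q ≠ G.target (G.bar G.tail)}

theorem firstArrival_ne_bar_tail (q : G.TrivalentVertex) : G.firstArrival q.1 ≠ G.bar G.tail :=
  fun h => q.2 ((G.target_firstArrival q.1).symm.trans (congrArg G.target h))

variable (G) in
/-- The edge along which the boundary cycle first arrives at a trivalent vertex. These edges form
a spanning tree rooted at the univalent vertex. -/
noncomputable def treeEdge (q : G.TrivalentVertex) : G.Edge :=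
  G.edge (G.firstArrival q.1)

theorem bar_firstArrival_ne (q q' : G.TrivalentVertex) :
    G.bar (G.firstArrival q.1) ≠ G.firstArrival q'.1 := by
  intro h
  have hlt := position_firstArrival_lt_bar (firstArrival_ne_bar_tail q)
  have hlt' := position_firstArrival_lt_bar (firstArrival_ne_bar_tail q')
  rw [target_firstArrival] at hlt hlt'
  rw [h] at hlt
  rw [← h, G.bar_bar, h] at hlt'
  exact hlt.asymm hlt'

theorem treeEdge_injective : Function.Injective G.treeEdge := by
  intro q q' h
  rcases G.edge_eq_iff.mp h with h | h
  · rw [Subtype.ext_iff, ← G.target_firstArrival q.1, ← h, target_firstArrival]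
  · exact absurd h.symm (bar_firstArrival_ne q q')

variable (G) in
/-- The edges outside the spanning tree. -/
abbrev CoEdge : Type u := {e : G.Edge // e ∉ Set.range G.treeEdge}

theorem position_firstArrival_lt_of_edge_eq_treeEdge {y : G.E} {q : G.TrivalentVertex}
    (hy : y ≠ G.bar G.tail) (hne : y ≠ G.firstArrival (G.target y))
    (hq : G.treeEdge q = G.edge y) :
    G.bar y = G.firstArrival q.1 ∧
      G.position (G.firstArrival (G.target y)) < G.position (G.firstArrival q.1) := by
  rcases G.edge_eq_iff.mp hq with h | h
  · exact absurd (by rw [h, target_firstArrival]) hne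
  · have hbar : G.bar y = G.firstArrival q.1 := by rw [h, G.bar_bar]
    exact ⟨hbar, hbar ▸ position_firstArrival_lt_bar hy⟩

-- Prune the leaves of the spanning tree: of the three edges at a trivalent vertex, the one of
-- first arrival is determined by the other two, which lie outside the tree or lead to vertices
-- that the boundary cycle reaches later.
theorem coEdge_induction {P : G.E → Prop} (bar : ∀ x, P x → P (G.bar x))
    (coEdge : ∀ e : G.CoEdge, P e.1.out)
    (vertex : ∀ x, x ≠ G.bar G.tail → P (G.next x) → P (G.next (G.next x)) → P x) (x : G.E) :
    P x := by
  have hedge : ∀ {x y}, G.edge x = G.edge y → P x → P y := fun h hx =>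
    (G.edge_eq_iff.mp h).elim (fun h => h ▸ hx) fun h => h ▸ bar _ hx
  have hco : ∀ x, G.edge x ∉ Set.range G.treeEdge → P x := fun x hx =>
    hedge (Quotient.out_eq (G.edge x)) (coEdge ⟨G.edge x, hx⟩)
  have htree : ∀ q : G.TrivalentVertex, P (G.firstArrival q.1) := by
    intro q
    induction hn : G.position (G.bar G.tail) - G.position (G.firstArrival q.1) using
      Nat.strong_induction_on generalizing q with
    | _ n ih =>
      have hother : ∀ y, G.target y = q.1 → y ≠ G.firstArrival q.1 → P y := by
        intro y hyq hne
        by_cases hy : G.edge y ∈ Set.range G.treeEdge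
        · obtain ⟨q', hq'⟩ := hy
          obtain ⟨hbar, hlt⟩ := position_firstArrival_lt_of_edge_eq_treeEdge
            (fun h => q.2 (by rw [← hyq, h])) (by rwa [hyq]) hq'
          have := position_lt_last (firstArrival_ne_bar_tail q)
          rw [← G.bar_bar y, hbar]
          exact bar _ (ih _ (by rw [hyq] at hlt; omega) q' rfl)
        · exact hco y hy
      have hx := firstArrival_ne_bar_tail q
      obtain ⟨hne, hnext⟩ := G.trivalent _ hx
      refine vertex _ hx (hother _ ?_ hne) (hother _ ?_ fun h => ?_)
      · rw [target_next, target_firstArrival]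
      · rw [target_next, target_next, target_firstArrival]
      · rw [h] at hnext
        exact hne hnext
  by_cases hx : G.edge x ∈ Set.range G.treeEdge
  · obtain ⟨q, hq⟩ := hx
    exact hedge hq (htree q)
  · exact hco x hx

theorem numCycles_boundary : numCycles G.boundary = 1 :=
  Nat.card_eq_one_iff_unique.mpr
    ⟨⟨fun a b => Quotient.inductionOn₂ a b fun x y => Quotient.sound (G.one_boundary x y)⟩,
      ⟨Quotient.mk _ G.tail⟩⟩

theorem numCycles_next : numCycles G.next = Nat.card G.TrivalentVertex + 1 := by
  classical
  have := G.finite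
  rw [numCycles, ← Nat.card_congr
    (Equiv.sumCompl fun q : G.Vertex => q = G.target (G.bar G.tail)), Nat.card_sum,
    Nat.card_unique, add_comm]

theorem numCycles_bar : numCycles G.bar = Nat.card G.TrivalentVertex + Nat.card G.CoEdge := by
  classical
  have := G.finite
  rw [numCycles, ← Nat.card_congr (Equiv.sumCompl fun e : G.Edge => e ∈ Set.range G.treeEdge),
    Nat.card_sum, Nat.card_congr (Equiv.ofInjective _ treeEdge_injective)]

theorem card_coEdge {g : ℕ} (hg : G.HasGenus g) : Nat.card G.CoEdge = 2 * g := by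
  rw [Fatgraph.HasGenus, numCycles_boundary, numCycles_next, numCycles_bar] at hg
  omega

end SpanningTree

end BorderedFatgraph

/-! ### Extension along a marking -/

namespace BorderedFatgraph

section MarkingRelations

variable {G : BorderedFatgraph.{u}}

/-- The relations of a marking, for a map on the oriented edges with values in any monoid: a map
that satisfies them represents the fundamental groupoid of the surface. -/
structure MarkingRelations {M : Type*} [Monoid M] (f : G.E → M) : Prop where
  bar : ∀ x, f (G.bar x) * f x = 1
  vertex : ∀ x, x ≠ G.bar G.tail → f x * f (G.next x) * f (G.next (G.next x)) = 1

namespace MarkingRelations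

/-- The values of a map that satisfies the relations of a marking are units. -/
def unit {M : Type*} [Monoid M] {f : G.E → M} (hf : MarkingRelations f) (x : G.E) : Mˣ where
  val := f x
  inv := f (G.bar x)
  val_inv := by simpa only [G.bar_bar] using hf.bar (G.bar x)
  inv_val := hf.bar x

theorem markingRelations_unit {M : Type*} [Monoid M] {f : G.E → M} (hf : MarkingRelations f) :
    MarkingRelations hf.unit where
  bar x := Units.ext (hf.bar x)
  vertex x hx := Units.ext (hf.vertex x hx)

theorem prodMk {M N : Type*} [Monoid M] [Monoid N] {f : G.E → M} {f' : G.E → N}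
    (hf : MarkingRelations f) (hf' : MarkingRelations f') :
    MarkingRelations fun x => (f x, f' x) where
  bar x := Prod.ext (hf.bar x) (hf'.bar x)
  vertex x hx := Prod.ext (hf.vertex x hx) (hf'.vertex x hx)

end MarkingRelations

/-- The homomorphism from the free group on the edges outside the spanning tree that is given by
the values of `f` on these edges, each with a chosen orientation. -/
noncomputable def coEdgeHom {M : Type*} [Group M] (f : G.E → M) : FreeGroup G.CoEdge →* M :=
  FreeGroup.lift fun e => f e.1.out

theorem MarkingRelations.mem_range_coEdgeHom {M : Type*} [Group M] {f : G.E → M}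
    (hf : MarkingRelations f) (x : G.E) : f x ∈ (coEdgeHom f).range := by
  induction x using coEdge_induction with
  | bar x hx =>
    rw [eq_inv_of_mul_eq_one_left (hf.bar x)]
    exact inv_mem hx
  | coEdge e => exact ⟨FreeGroup.of e, FreeGroup.lift_apply_of ..⟩
  | vertex x hx hnext hnext' =>
    rw [eq_inv_of_mul_eq_one_left ((mul_assoc _ _ _).symm.trans (hf.vertex x hx))]
    exact inv_mem (mul_mem hnext hnext')

theorem coEdgeHom_prodMk {M N : Type*} [Group M] [Group N] (f : G.E → M) (f' : G.E → N) :
    coEdgeHom (fun x => (f x, f' x)) = (coEdgeHom f).prod (coEdgeHom f') :=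
  FreeGroup.ext_hom _ _ fun e => by
    simp [coEdgeHom]

end MarkingRelations

end BorderedFatgraph

namespace MarkedFatgraph

open BorderedFatgraph

variable {g : ℕ} (G : MarkedFatgraph.{u} g)

theorem markingRelations_marking : MarkingRelations G.marking :=
  ⟨G.orientation, G.vertex⟩

theorem coEdgeHom_marking_bijective : Function.Bijective (coEdgeHom G.marking) := by
  have := G.finite
  obtain ⟨e⟩ : Nonempty (G.CoEdge ≃ Fin g ⊕ Fin g) := by
    rw [← Finite.card_eq, card_coEdge G.genus, Nat.card_sum, Nat.card_fin, two_mul]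
  refine freeGroup_bijective_of_surjective e ?_
  rw [← MonoidHom.range_eq_top, eq_top_iff, ← G.full_rank, Subgroup.closure_le]
  rintro _ ⟨x, rfl⟩
  exact G.markingRelations_marking.mem_range_coEdgeHom x

variable {G} in
theorem exists_extension_of_group {M : Type*} [Group M] {f : G.E → M} (hf : MarkingRelations f) :
    ∃ θ : SurfaceGroup g →* M, ∀ x, θ (G.marking x) = f x := by
  let P := MulEquiv.ofBijective _ G.coEdgeHom_marking_bijective
  refine ⟨(coEdgeHom f).comp P.symm.toMonoidHom, fun x => ?_⟩
  obtain ⟨w, hw⟩ := (G.markingRelations_marking.prodMk hf).mem_range_coEdgeHom x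
  rw [coEdgeHom_prodMk, MonoidHom.prod_apply, Prod.mk_inj] at hw
  rw [← hw.1, ← hw.2]
  exact congrArg (coEdgeHom f) (P.symm_apply_apply w)

variable {G} in
theorem exists_extension {M : Type*} [Monoid M] {f : G.E → M} (hf : MarkingRelations f) :
    ∃ θ : SurfaceGroup g →* M, ∀ x, θ (G.marking x) = f x := by
  obtain ⟨θ, hθ⟩ := exists_extension_of_group hf.markingRelations_unit
  exact ⟨(Units.coeHom M).comp θ, fun x => congrArg Units.val (hθ x)⟩

variable {G} in
theorem hom_ext {M : Type*} [Monoid M] {θ θ' : SurfaceGroup g →* M}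
    (h : ∀ x, θ (G.marking x) = θ' (G.marking x)) : θ = θ' :=
  MonoidHom.eq_of_eqOn_dense G.full_rank (Set.forall_mem_range.mpr h)

end MarkedFatgraph

/-! ### Rational homology -/

section Homology

variable {F : Type*} [Group F]

theorem homologyClass_mul (a b : F) :
    homologyClass (a * b) = homologyClass a + homologyClass b := by
  simp only [homologyClass, map_mul, ofMul_mul, TensorProduct.tmul_add]

theorem homologyClass_one : homologyClass (1 : F) = 0 := by
  simp only [homologyClass, map_one, ofMul_one, TensorProduct.tmul_zero]

theorem homologyClass_inv (a : F) : homologyClass a⁻¹ = -homologyClass a := by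
  rw [eq_neg_iff_add_eq_zero, ← homologyClass_mul, inv_mul_cancel, homologyClass_one]

theorem homologyMap_homologyClass (φ : MulAut F) (a : F) :
    homologyMap φ (homologyClass a) = homologyClass (φ a) := by
  rw [homologyMap, homologyClass, LinearMap.baseChange_tmul]
  rfl

theorem isGeneralizedMagnusExpansion_of_closure
    {θ : F →* CompletedTensorAlgebra (RatHomology F)} {s : Set F} (hs : Subgroup.closure s = ⊤)
    (h : ∀ a ∈ s, comp 0 (θ a) = 1 ∧ comp 1 (θ a) = TensorAlgebra.ι ℚ (homologyClass a)) :
    IsGeneralizedMagnusExpansion θ := by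
  intro a
  have ha : a ∈ Subgroup.closure s := hs ▸ Subgroup.mem_top a
  induction ha using Subgroup.closure_induction with
  | mem a ha => exact h a ha
  | one => simp [homologyClass_one, comp_one]
  | mul a b _ _ iha ihb =>
    rw [map_mul, comp_zero_mul, comp_one_mul, iha.1, iha.2, ihb.1, ihb.2, homologyClass_mul,
      map_add, one_mul, one_mul, mul_one]
    exact ⟨rfl, add_comm _ _⟩
  | inv a _ iha =>
    have hmul : θ a⁻¹ * θ a = 1 := by rw [← map_mul, inv_mul_cancel, map_one]
    have hzero := congrArg (comp 0) hmul
    have hone := congrArg (comp 1) hmul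
    rw [comp_zero_mul, iha.1, mul_one, comp_one, if_pos rfl] at hzero
    rw [comp_one_mul, iha.1, iha.2, hzero, mul_one, one_mul, comp_one, if_neg one_ne_zero] at hone
    exact ⟨hzero, by rw [homologyClass_inv, map_neg]; exact eq_neg_of_add_eq_zero_right hone⟩

end Homology

/-! ### Naturality of the recursion -/

namespace BorderedFatgraph

/-- An isomorphism of the underlying fatgraphs; it preserves the tail automatically. -/
structure Iso (G G' : BorderedFatgraph.{u}) where
  toEquiv : G.E ≃ G'.E
  map_bar : ∀ x, toEquiv (G.bar x) = G'.bar (toEquiv x)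
  map_next : ∀ x, toEquiv (G.next x) = G'.next (toEquiv x)

variable {G G' : BorderedFatgraph.{u}}

namespace Iso

variable (e : Iso G G')

theorem map_bar_tail : e.toEquiv (G.bar G.tail) = G'.bar G'.tail := by
  by_contra h
  exact (G'.trivalent _ h).1 (by rw [← e.map_next, G.univalent])

theorem map_path (x : G.E) (i : ℕ) : e.toEquiv (G.path x i) = G'.path (e.toEquiv x) i := by
  induction i with
  | zero => rfl
  | succ i ih => rw [path_succ, path_succ, e.map_bar, e.map_next, ih]

theorem pathLength_apply (x : G.E) : G'.pathLength (e.toEquiv x) = G.pathLength x := by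
  refine le_antisymm (pathLength_le ?_) (pathLength_le (e.toEquiv.injective ?_))
  · rw [← e.map_path, path_pathLength, e.map_bar]
  · rw [e.map_path, path_pathLength, e.map_bar]

theorem avoidsTail_apply (x : G.E) : G'.AvoidsTail (e.toEquiv x) ↔ G.AvoidsTail x := by
  simp only [AvoidsTail, e.pathLength_apply, ← e.map_path, ← e.map_bar_tail, ne_eq,
    e.toEquiv.injective.eq_iff]

end Iso

variable {V : Type*} [AddCommGroup V] [Module ℚ V]

theorem SolvesRecursion.comp_iso {m : G'.E → V} {L : G'.E → CompletedTensorAlgebra V}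
    (h : G'.SolvesRecursion m L) (e : Iso G G') :
    G.SolvesRecursion (m ∘ e.toEquiv) (L ∘ e.toEquiv) := by
  refine fun x => ⟨(h _).1, (h _).2.1, fun n hn => ?_⟩
  simpa only [Function.comp_apply, e.avoidsTail_apply, e.pathLength_apply, e.map_path, e.map_bar]
    using (h (e.toEquiv x)).2.2 n hn

theorem SolvesRecursion.map {W : Type*} [AddCommGroup W] [Module ℚ W] (f : V →ₗ[ℚ] W)
    {m : G.E → V} {L : G.E → CompletedTensorAlgebra V} (h : G.SolvesRecursion m L) :
    G.SolvesRecursion (f ∘ m) (completedTensorHom f ∘ L) := by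
  refine fun x => ⟨?_, ?_, fun n hn => ⟨fun hx => ?_, fun hx => ?_⟩⟩
  · rw [Function.comp_apply, comp_completedTensorHom, (h x).1, map_zero]
  · rw [Function.comp_apply, comp_completedTensorHom, (h x).2.1, tensorMap,
      TensorAlgebra.lift_ι_apply]
    rfl
  · simp only [Function.comp_apply, ← map_neg, ← completedTensorHom_hausdorff,
      comp_completedTensorHom, ((h x).2.2 n hn).1 hx, map_smul, map_sum]
  · simp only [Function.comp_apply, comp_completedTensorHom, ((h x).2.2 n hn).2 hx, map_neg]

theorem ell_iso (m : G'.E → V) (e : Iso G G') (x : G.E) :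
    G'.ell m (e.toEquiv x) = G.ell (m ∘ e.toEquiv) x :=
  congrFun (((solvesRecursion_ell m).comp_iso e).unique (solvesRecursion_ell _)) x

theorem completedTensorHom_ell {W : Type*} [AddCommGroup W] [Module ℚ W] (f : V →ₗ[ℚ] W)
    (m : G.E → V) (x : G.E) : completedTensorHom f (G.ell m x) = G.ell (f ∘ m) x :=
  congrFun (((solvesRecursion_ell m).map f).unique (solvesRecursion_ell _)) x

end BorderedFatgraph

/-! ### Fatgraph Magnus expansions -/

namespace MarkedFatgraph

open BorderedFatgraph

variable {g : ℕ} (G : MarkedFatgraph.{u} g)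

theorem hMarking_bar (x : G.E) : G.hMarking (G.bar x) = -G.hMarking x := by
  rw [eq_neg_iff_add_eq_zero, hMarking, hMarking, ← homologyClass_mul, G.orientation,
    homologyClass_one]

theorem hMarking_vertex (x : G.E) (hx : x ≠ G.bar G.tail) :
    G.hMarking x + G.hMarking (G.next x) + G.hMarking (G.next (G.next x)) = 0 := by
  rw [hMarking, hMarking, hMarking, ← homologyClass_mul, ← homologyClass_mul, G.vertex x hx,
    homologyClass_one]

theorem markingRelations_theta : MarkingRelations G.theta where
  bar x := by
    rw [theta, theta, (solvesRecursion_ell G.hMarking).apply_bar G.hMarking_bar]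
    exact expT_neg_mul_expT (comp_zero_ell _ x)
  vertex _ hx := (solvesRecursion_ell G.hMarking).expT_vertex G.hMarking_bar G.hMarking_vertex hx

theorem comp_theta (x : G.E) : comp 0 (G.theta x) = 1 ∧
    comp 1 (G.theta x) = TensorAlgebra.ι ℚ (homologyClass (G.marking x)) :=
  ⟨comp_zero_expT _, (comp_one_expT (comp_zero_ell _ x)).trans (comp_one_ell _ x)⟩

/-- The fatgraph Magnus expansion `θ^G` of the fundamental group: the extension of `exp ∘ ℓ` along
the marking. -/
noncomputable def magnusExpansion :
    SurfaceGroup g →* CompletedTensorAlgebra (RatHomology (SurfaceGroup g)) :=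
  (exists_extension G.markingRelations_theta).choose

theorem magnusExpansion_marking (x : G.E) : G.magnusExpansion (G.marking x) = G.theta x :=
  (exists_extension G.markingRelations_theta).choose_spec x

theorem isGeneralizedMagnusExpansion_magnusExpansion :
    IsGeneralizedMagnusExpansion G.magnusExpansion := by
  refine isGeneralizedMagnusExpansion_of_closure G.full_rank (Set.forall_mem_range.mpr fun x => ?_)
  rw [magnusExpansion_marking]
  exact G.comp_theta x

variable {G}

/-- Forget that an isomorphism of fatgraphs matches the `H`-markings. -/
def HIso.toIso {G' : MarkedFatgraph.{u} g} (e : G.HIso G') :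
    Iso G.toBorderedFatgraph G'.toBorderedFatgraph :=
  ⟨e.toEquiv, e.map_bar, e.map_next⟩

theorem theta_hIso {G' : MarkedFatgraph.{u} g} (e : G.HIso G') (x : G.E) :
    G'.theta (e.toEquiv x) = G.theta x := by
  have hm : G'.hMarking ∘ e.toEquiv = G.hMarking := funext e.map_hMarking
  have hell := ell_iso G'.hMarking e.toIso x
  exact congrArg expT (hell.trans (congrArg (G.ell · x) hm))

variable (G)

theorem completedTensorHom_theta_act (φ : mappingClassGroup g) (x : G.E) :
    completedTensorHom (homologyMap (φ⁻¹).1) ((G.act φ).theta x) = G.theta x := by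
  set f := homologyMap (φ⁻¹).1
  have hm : f ∘ (G.act φ).hMarking = G.hMarking := funext fun y =>
    (homologyMap_homologyClass _ _).trans
      (congrArg homologyClass (MulAut.inv_apply_self _ φ.1 (G.marking y)))
  calc
    completedTensorHom f ((G.act φ).theta x)
      = expT (completedTensorHom f (G.ell (G.act φ).hMarking x)) := completedTensorHom_expT f _
    _ = expT (G.ell (f ∘ (G.act φ).hMarking) x) :=
      congrArg expT (completedTensorHom_ell f (G.act φ).hMarking x)
    _ = G.theta x := congrArg (fun m => expT (G.ell m x)) hm

theorem magnusExpansion_act (φ : mappingClassGroup g) (a : SurfaceGroup g) :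
    G.magnusExpansion a =
      completedTensorMap (homologyMap (φ⁻¹).1) ((G.act φ).magnusExpansion (φ.1 a)) := by
  have h : G.magnusExpansion = ((completedTensorHom (homologyMap (φ⁻¹).1)).toMonoidHom.comp
      (G.act φ).magnusExpansion).comp (MulEquiv.toMonoidHom φ.1) := hom_ext fun x => by
    rw [magnusExpansion_marking, ← G.completedTensorHom_theta_act φ]
    exact congrArg _ ((G.act φ).magnusExpansion_marking x).symm
  exact DFunLike.congr_fun h a

end MarkedFatgraph

end FatgraphMagnus

theorem theorem4p2 (g : ℕ) (hg : 0 < g) :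
    -- the recursive definition is well posed, and `ℓ` takes values in the free Lie algebra
    (∀ G : MarkedFatgraph.{u} g,
      G.SolvesRecursion G.hMarking (G.ell G.hMarking) ∧
      (∀ L, G.SolvesRecursion G.hMarking L → L = G.ell G.hMarking) ∧
      ∀ (x : G.E) (n : ℕ), comp n (G.ell G.hMarking x) ∈ freeLie (RatHomology (SurfaceGroup g))) ∧
    -- the fatgraph Magnus expansions `Θ G`
    ∃ Θ : MarkedFatgraph.{u} g →
        (SurfaceGroup g →* CompletedTensorAlgebra (RatHomology (SurfaceGroup g))),
      (∀ G, IsGeneralizedMagnusExpansion (Θ G)) ∧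
      -- `Θ G` extends the map `x ↦ exp (ℓ(x))` on oriented edges, and it is the only extension
      (∀ G x, Θ G (G.marking x) = G.theta x) ∧
      (∀ G (θ : SurfaceGroup g →* CompletedTensorAlgebra (RatHomology (SurfaceGroup g))),
        (∀ x, θ (G.marking x) = G.theta x) → θ = Θ G) ∧
      -- on oriented edges it depends only on the combinatorics and the `H`-marking
      (∀ (G G' : MarkedFatgraph.{u} g) (e : G.HIso G') (x : G.E),
        Θ G' (G'.marking (e.toEquiv x)) = Θ G (G.marking x)) ∧
      -- equivariance under the mapping class group
      (∀ (φ : mappingClassGroup g) (G : MarkedFatgraph.{u} g) (a : SurfaceGroup g),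
        Θ G a = completedTensorMap (homologyMap (φ⁻¹).1) (Θ (G.act φ) (φ.1 a))) := by
  refine ⟨fun G => ⟨BorderedFatgraph.solvesRecursion_ell _,
      fun L hL => hL.unique (BorderedFatgraph.solvesRecursion_ell _),
      fun x n => BorderedFatgraph.comp_ell_mem_freeLie _ n x⟩,
    MarkedFatgraph.magnusExpansion, ?magnus, ?extension, ?unique, ?combinatorial, ?equivariant⟩
  case magnus => exact MarkedFatgraph.isGeneralizedMagnusExpansion_magnusExpansion
  case extension => exact MarkedFatgraph.magnusExpansion_marking
  case unique =>
    exact fun G θ hθ => MarkedFatgraph.hom_ext fun x => by rw [hθ, G.magnusExpansion_marking]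
  case combinatorial =>
    intro G G' e x
    rw [G.magnusExpansion_marking, G'.magnusExpansion_marking, MarkedFatgraph.theta_hIso]
  case equivariant => exact fun φ G a => G.magnusExpansion_act φ a
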